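/- Let $G$ be a (connected) semi-simple algebraic group over $\mathbb{C}$, identified with its group of complex points. Fix a maximal torus $T$ of $G$ and a base $\alpha_1,\dots,\alpha_r$ of its root system. The highest weight $\lambda$ of a finite-dimensional irreducible rational representation $W$ of $G$ is recorded by the non-negative integers $\lambda_j=\langle\lambda,\alpha_j^\vee\rangle$, $1\le j\le r$. *Rank functions.* Let $\Delta\le G$ be a subgroup and let $A$ be an $s\times t$ matrix over $\mathbb{C}[\Delta]$. Put $\operatorname{rk}^{\Delta}_{W}(A)=\dim_{\mathbb C}\operatorname{Im}(A\colon W^t\to W^s)/\dim_{\mathbb C}W$. Let $\chi\colon Z(G)\to\mathbb{C}^\times$ be a character, and let $\ell^2(\Delta)_\chi$ be the GNS Hilbert space, with cyclic unit vector $e$, of the trace on $\mathbb{C}[\Delta]$ given by $g\mapsto\chi(g)$ for $g\in Z(G)\cap\Delta$ and $g\mapsto 0$ for the other elements $g$ of $\Delta$. The twisted von Neumann rank is $\operatorname{rk}^{\chi}_{\Delta}(A)=\sum_{k=1}^{s}\langle Pe_k,e_k\rangle$, where $P$ is the orthogonal projection of $\ell^2(\Delta)_\chi^{\,s}$ onto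 the closure of $A\cdot\ell^2(\Delta)_\chi^{\,t}$ and $e_k$ is the vector $e$ placed in the $k$-th coordinate. The subgroup $\Delta$ *satisfies the quantitative rank conjecture* if for every character $\chi$ of $Z(G)$ and every matrix $A$ over $\mathbb{C}[\Delta]$ there is a constant $C$ such that $$\left|\operatorname{rk}^{\Delta}_{W}(A)-\operatorname{rk}^{\chi}_{\Delta}(A)\right|\le\frac{C}{\min_j\lambda_j}$$ for all finite-dimensional irreducible rational representations $W$ of $G$ on which $Z(G)$ acts through $\chi$ and for which $\min_j\lambda_j\ge1$. A subgroup $\Gamma\le G$ *virtually* satisfies the conjecture if some finite index subgroup of $\Gamma$ satisfies it. **Proposition.** Let $n\ge 0$ and let $\Gamma\le G$ be a torsion-free subgroup (not necessarily discrete) of type $FP_{n+1}$ over $\mathbb{C}$ that virtually satisfies the quantitative rank conjecture. Let $0\le i\le n$ and suppose that the $i$-th $\ell^2$-Betti number $b_i^{(2)}(\Gamma)$, the von Neumann dimension of $H_i(\Gamma;\mathcal N(\Gamma))$, is zero. Then there is a constant $C$ such that for every finite-dimensional irreducible rational representation $W$ of $G$ of highest weight $(\lambda_1,\dots,\lambda_r)$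 with $\min_j\lambda_j\ge1$, the space $H^i(\Gamma,W)$ is finite-dimensional and $$\frac{\dim_{\mathbb C}H^i(\Gamma,W)}{\dim_{\mathbb C}W}\le\frac{C}{\min\{\lambda_1,\dots,\lambda_r\}}.$$ -/

import Mathlib

noncomputable section

namespace SemisimpleGrowth

/-! ### Linear algebraic groups over `ℂ`

A linear algebraic group is a Zariski closed subgroup of some `GL_N(ℂ)`. -/

/-- The value of a polynomial in the `N²` matrix entries at an invertible matrix. -/
def evalAt {N : ℕ} (p : MvPolynomial (Fin N × Fin N) ℂ) (g : GL (Fin N) ℂ) : ℂ :=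
  MvPolynomial.eval (fun ij => (g : Matrix (Fin N) (Fin N) ℂ) ij.1 ij.2) p

/-- Zariski closed subsets of `GL_N(ℂ)`: the zero loci of sets of polynomials in the entries. -/
def IsZariskiClosed {N : ℕ} (S : Set (GL (Fin N) ℂ)) : Prop :=
  ∃ I : Set (MvPolynomial (Fin N × Fin N) ℂ), S = {g | ∀ p ∈ I, evalAt p g = 0}

/-- Connectedness of a (nonempty) subset of `GL_N(ℂ)` for the Zariski topology. -/
def IsZariskiConnected {N : ℕ} (S : Set (GL (Fin N) ℂ)) : Prop :=
  S.Nonempty ∧ ∀ A B : Set (GL (Fin N) ℂ), IsZariskiClosed A → IsZariskiClosed B →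
    S ⊆ A ∪ B → S ∩ (A ∩ B) = ∅ → S ⊆ A ∨ S ⊆ B

/-- A semi-simple algebraic group over `ℂ`: a connected linear algebraic group whose only
connected solvable normal closed subgroup is the trivial one. -/
structure IsSemisimpleGroup {N : ℕ} (G : Subgroup (GL (Fin N) ℂ)) : Prop where
  closed : IsZariskiClosed (G : Set (GL (Fin N) ℂ))
  connected : IsZariskiConnected (G : Set (GL (Fin N) ℂ))
  radical_trivial : ∀ R : Subgroup (GL (Fin N) ℂ), R ≤ G →
    IsZariskiClosed (R : Set (GL (Fin N) ℂ)) → IsZariskiConnected (R : Set (GL (Fin N) ℂ)) →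
    Group.IsSolvable R → (R.subgroupOf G).Normal → R = ⊥

/-- Regular functions on a closed subgroup of `GL_N(ℂ)`: restrictions of polynomials in the matrix
entries and in the inverse of the determinant. -/
def IsRegular {N : ℕ} {H : Subgroup (GL (Fin N) ℂ)} (f : H → ℂ) : Prop :=
  ∃ (p : MvPolynomial (Fin N × Fin N) ℂ) (k : ℕ), ∀ h : H,
    f h = evalAt p h * ((h : GL (Fin N) ℂ) : Matrix (Fin N) (Fin N) ℂ).det⁻¹ ^ k

/-- Tori: connected closed subgroups that can be diagonalized by a change of basis. -/
structure IsTorus {N : ℕ} (T : Subgroup (GL (Fin N) ℂ)) : Prop where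
  closed : IsZariskiClosed (T : Set (GL (Fin N) ℂ))
  connected : IsZariskiConnected (T : Set (GL (Fin N) ℂ))
  diagonalizable : ∃ x : GL (Fin N) ℂ, ∀ t ∈ T,
    ((x * t * x⁻¹ : GL (Fin N) ℂ) : Matrix (Fin N) (Fin N) ℂ).IsDiag

/-- Maximal tori of `G`. -/
structure IsMaximalTorus {N : ℕ} (G T : Subgroup (GL (Fin N) ℂ)) : Prop where
  torus : IsTorus T
  le : T ≤ G
  maximal : ∀ T' : Subgroup (GL (Fin N) ℂ), IsTorus T' → T' ≤ G → T ≤ T' → T' = T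

/-- Algebraic characters `T → ℂˣ` (morphisms of algebraic groups from `T` to `GL_1`). -/
def IsCharacter {N : ℕ} {T : Subgroup (GL (Fin N) ℂ)} (μ : T →* ℂˣ) : Prop :=
  IsRegular (fun t => (μ t : ℂ)) ∧ IsRegular (fun t => ((μ t)⁻¹ : ℂ))

/-- Algebraic cocharacters `ℂˣ → T`: the matrix entries of `γ a` are Laurent polynomials in `a`. -/
def IsCocharacter {N : ℕ} {T : Subgroup (GL (Fin N) ℂ)} (γ : ℂˣ →* T) : Prop :=
  ∀ i j, ∃ (p : Polynomial ℂ) (k : ℕ), ∀ a : ℂˣ,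
    ((γ a : GL (Fin N) ℂ) : Matrix (Fin N) (Fin N) ℂ) i j = p.eval (a : ℂ) * ((a : ℂ)⁻¹) ^ k

/-- The Lie algebra of the closed subgroup `G`: the Zariski tangent space of `G` at the identity,
as a set of matrices. -/
def lieAlg {N : ℕ} (G : Subgroup (GL (Fin N) ℂ)) : Set (Matrix (Fin N) (Fin N) ℂ) :=
  {X | ∀ p : MvPolynomial (Fin N × Fin N) ℂ, (∀ g ∈ G, evalAt p g = 0) →
    ∑ ij : Fin N × Fin N, X ij.1 ij.2 * evalAt (MvPolynomial.pderiv ij p) 1 = 0}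

/-- Roots of `G` with respect to `T`: the nontrivial characters of `T` occurring in the adjoint
action of `T` on the Lie algebra of `G`. -/
def IsRoot {N : ℕ} (G : Subgroup (GL (Fin N) ℂ)) {T : Subgroup (GL (Fin N) ℂ)}
    (α : T →* ℂˣ) : Prop :=
  IsCharacter α ∧ α ≠ 1 ∧ ∃ X ∈ lieAlg G, X ≠ 0 ∧ ∀ t : T,
    ((t : GL (Fin N) ℂ) : Matrix (Fin N) (Fin N) ℂ) * X *
      (((t : GL (Fin N) ℂ)⁻¹ : GL (Fin N) ℂ) : Matrix (Fin N) (Fin N) ℂ) = (α t : ℂ) • X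

/-- `γ` is the coroot `α^∨` of the root `α`: the cocharacter with `⟨α, α^∨⟩ = 2` such that the
reflection `β ↦ β - ⟨β, α^∨⟩ α` preserves the set of roots (characters are written
multiplicatively). -/
def IsCoroot {N : ℕ} (G : Subgroup (GL (Fin N) ℂ)) {T : Subgroup (GL (Fin N) ℂ)}
    (α : T →* ℂˣ) (γ : ℂˣ →* T) : Prop :=
  IsCocharacter γ ∧ (∀ a, α (γ a) = a ^ 2) ∧
    ∀ β : T →* ℂˣ, IsRoot G β → ∃ m : ℤ, (∀ a, β (γ a) = a ^ m) ∧ IsRoot G (β * α ^ (-m))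

/-- A choice of a maximal torus of `G` and of a base of its root system (equivalently, of a set of
positive roots), with the corresponding simple roots `α_1, …, α_n` and simple coroots. -/
structure SimpleSystem {N : ℕ} (G : Subgroup (GL (Fin N) ℂ)) (n : ℕ) where
  /-- the maximal torus -/
  torus : Subgroup (GL (Fin N) ℂ)
  isMaximalTorus : IsMaximalTorus G torus
  /-- the simple roots -/
  root : Fin n → (torus →* ℂˣ)
  isRoot : ∀ i, IsRoot G (root i)
  independent : ∀ k : Fin n → ℤ, ∏ i, root i ^ k i = 1 → k = 0
  pos_or_neg : ∀ β : torus →* ℂˣ, IsRoot G β →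
    ∃ m : Fin n → ℕ, β = ∏ i, root i ^ m i ∨ β⁻¹ = ∏ i, root i ^ m i
  /-- the simple coroots -/
  coroot : Fin n → (ℂˣ →* torus)
  isCoroot : ∀ i, IsCoroot G (root i) (coroot i)

/-- Rational representations of the algebraic group `G`: all matrix coefficients are regular. -/
def IsRational {N : ℕ} {G : Subgroup (GL (Fin N) ℂ)} {W : Type} [AddCommGroup W] [Module ℂ W]
    (ρ : Representation ℂ G W) : Prop :=
  ∀ (f : Module.Dual ℂ W) (w : W), IsRegular (fun g : G => f (ρ g w))

/-- Weights of a maximal torus in a representation of `G`. -/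
def IsWeight {N : ℕ} {G : Subgroup (GL (Fin N) ℂ)} {n : ℕ} (D : SimpleSystem G n)
    {W : Type} [AddCommGroup W] [Module ℂ W] (ρ : Representation ℂ G W)
    (μ : D.torus →* ℂˣ) : Prop :=
  ∃ w : W, w ≠ 0 ∧ ∀ t : D.torus,
    ρ (Subgroup.inclusion D.isMaximalTorus.le t) w = (μ t : ℂ) • w

/-- The weight `μ` is the highest weight of the representation `ρ`: every weight of `ρ` is obtained
from `μ` by subtracting simple roots. -/
def IsHighestWeight {N : ℕ} {G : Subgroup (GL (Fin N) ℂ)} {n : ℕ} (D : SimpleSystem G n)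
    {W : Type} [AddCommGroup W] [Module ℂ W] (ρ : Representation ℂ G W)
    (μ : D.torus →* ℂˣ) : Prop :=
  IsWeight D ρ μ ∧ ∀ ν : D.torus →* ℂˣ, IsWeight D ρ ν →
    ∃ m : Fin n → ℕ, μ = ν * ∏ i, D.root i ^ m i

/-- `ρ` is a finite-dimensional irreducible rational representation of `G` whose highest weight has
parameters `l = (λ_1, …, λ_n)`, where `λ_i = ⟨λ, α_i^∨⟩`. -/
structure IsIrrepOfWeight {N : ℕ} {G : Subgroup (GL (Fin N) ℂ)} {n : ℕ} (D : SimpleSystem G n)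
    {W : Type} [AddCommGroup W] [Module ℂ W] (ρ : Representation ℂ G W) (l : Fin n → ℕ) :
    Prop where
  finiteDimensional : FiniteDimensional ℂ W
  rational : IsRational ρ
  irreducible : ρ.IsIrreducible
  highestWeight : ∃ μ : D.torus →* ℂˣ, IsHighestWeight D ρ μ ∧
    ∀ i a, μ (D.coroot i a) = a ^ l i

/-! ### Rank functions -/

/-- The action of an `r × s` matrix over the group algebra on column vectors with entries in a
representation. -/
def matrixAction {Γ V : Type} [Group Γ] [AddCommGroup V] [Module ℂ V] (ρ : Representation ℂ Γ V)
    {r s : ℕ} (A : Matrix (Fin r) (Fin s) (MonoidAlgebra ℂ Γ)) : (Fin s → V) →ₗ[ℂ] (Fin r → V) :=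
  LinearMap.pi fun i => ∑ j, (ρ.asAlgebraHom (A i j)) ∘ₗ LinearMap.proj j

/-- The Sylvester rank function induced by a finite-dimensional representation `W`. -/
def repRank {Γ W : Type} [Group Γ] [AddCommGroup W] [Module ℂ W] (ρ : Representation ℂ Γ W)
    {r s : ℕ} (A : Matrix (Fin r) (Fin s) (MonoidAlgebra ℂ Γ)) : ℝ :=
  (Module.finrank ℂ (LinearMap.range (matrixAction ρ A)) : ℝ) / Module.finrank ℂ W

/-- The Hilbert space `ℓ²(Γ)`. -/
abbrev ell2 (Γ : Type) : Type := lp (fun _ : Γ => ℂ) 2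

/-- The basis vector `δ_g` of `ℓ²(Γ)`. -/
def ell2.delta {Γ : Type} (g : Γ) : ell2 Γ :=
  letI := Classical.decEq Γ
  lp.single 2 g (1 : ℂ)

lemma ell2.memℓp_comp {Γ : Type} (σ : Equiv.Perm Γ) (f : ell2 Γ) :
    Memℓp (fun x => f (σ x)) 2 := by
  have h := (memℓp_gen_iff (p := 2) (by norm_num)).1 (lp.memℓp f)
  exact (memℓp_gen_iff (p := 2) (by norm_num)).2 (σ.summable_iff.2 h)

/-- The unitary operator on `ℓ²(Γ)` that sends `δ_g` to `δ_(σ g)`, for a permutation `σ`. -/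
def ell2.perm {Γ : Type} (σ : Equiv.Perm Γ) : ell2 Γ →ₗᵢ[ℂ] ell2 Γ where
  toFun f := ⟨fun x => f (σ⁻¹ x), ell2.memℓp_comp σ⁻¹ f⟩
  map_add' f g := by ext x; rfl
  map_smul' c f := by ext x; rfl
  norm_map' f := by
    rw [lp.norm_eq_tsum_rpow (by norm_num), lp.norm_eq_tsum_rpow (by norm_num)]
    congr 1
    exact Equiv.tsum_eq (σ⁻¹) (fun x => ‖f x‖ ^ (2 : ENNReal).toReal)

lemma ell2.perm_apply {Γ : Type} (σ : Equiv.Perm Γ) (f : ell2 Γ) (x : Γ) :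
    ell2.perm σ f x = f (σ⁻¹ x) := rfl

/-- The left regular representation of `Γ` on `ℓ²(Γ)`: `g • δ_h = δ_(gh)`. -/
def leftRegular (Γ : Type) [Group Γ] : Representation ℂ Γ (ell2 Γ) where
  toFun g := (ell2.perm (Equiv.mulLeft g)).toLinearMap
  map_one' := by
    ext f x
    change f ((Equiv.mulLeft (1 : Γ))⁻¹ x) = f x
    simp
  map_mul' g h := by
    ext f x
    change f ((Equiv.mulLeft (g * h))⁻¹ x) = f ((Equiv.mulLeft h)⁻¹ ((Equiv.mulLeft g)⁻¹ x))
    simp [mul_assoc]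

/-- For a character `χ` of a finite central subgroup `Z`, the unit vector
`|Z|^(-1/2) ∑_{z ∈ Z} χ(z)⁻¹ δ_z` of `ℓ²(Γ)`. It satisfies `⟨g • e, e⟩ = χ(g)` for `g ∈ Z` and
`⟨g • e, e⟩ = 0` for `g ∉ Z`, so that it is a cyclic vector for the GNS representation of the trace
`tr_χ`. -/
def twistedVector {Γ : Type} [Group Γ] (Z : Subgroup Γ) (χ : Z →* ℂˣ) : ell2 Γ :=
  ((Real.sqrt (Nat.card Z) : ℂ)⁻¹) • ∑ᶠ z : Z, ((χ z : ℂ)⁻¹) • ell2.delta (z : Γ)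

/-- The twisted `ℓ²`-completion `ℓ²(Γ)_χ` of `ℂ[Γ]`: the GNS space of `tr_χ`, realized as the closed
invariant subspace of `ℓ²(Γ)` generated by the cyclic vector. -/
def twistedEll2 {Γ : Type} [Group Γ] (Z : Subgroup Γ) (χ : Z →* ℂˣ) : Submodule ℂ (ell2 Γ) :=
  (Submodule.span ℂ (Set.range fun g : Γ => leftRegular Γ g (twistedVector Z χ))).topologicalClosure

/-- The closure of the image of `(ℓ²(Γ)_χ)^s` in `(ℓ²(Γ)_χ)^r` (itself inside the Hilbert space
`ℓ²(Γ)^r`) under left multiplication by an `r × s` matrix over `ℂ[Γ]`. -/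
def twistedImage {Γ : Type} [Group Γ] (Z : Subgroup Γ) (χ : Z →* ℂˣ) {r s : ℕ}
    (A : Matrix (Fin r) (Fin s) (MonoidAlgebra ℂ Γ)) :
    Submodule ℂ (PiLp 2 fun _ : Fin r => ell2 Γ) :=
  ((Submodule.pi Set.univ fun _ : Fin s => twistedEll2 Z χ).map
    ((WithLp.linearEquiv 2 ℂ (Fin r → ell2 Γ)).symm.toLinearMap ∘ₗ
      matrixAction (leftRegular Γ) A)).topologicalClosure

/-- The twisted von Neumann rank `rk_Γ^χ A = ∑_i ⟨P e_i, e_i⟩`, where `P` is the orthogonal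
projection onto the closure of the image of `A` and `e_i` is the cyclic vector in the `i`-th
coordinate. -/
def twistedRank {Γ : Type} [Group Γ] (Z : Subgroup Γ) (χ : Z →* ℂˣ) {r s : ℕ}
    (A : Matrix (Fin r) (Fin s) (MonoidAlgebra ℂ Γ)) : ℝ :=
  haveI : CompleteSpace (twistedImage Z χ A) := Submodule.topologicalClosure.completeSpace _
  ∑ i : Fin r,
    (inner ℂ (PiLp.single 2 (β := fun _ : Fin r => ell2 Γ) i (twistedVector Z χ))
      ((twistedImage Z χ A).starProjection
        (PiLp.single 2 (β := fun _ : Fin r => ell2 Γ) i (twistedVector Z χ)))).re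

/-! ### The group von Neumann algebra and `ℓ²`-Betti numbers -/

/-- The group von Neumann algebra `N(Γ)`: the bounded operators on `ℓ²(Γ)` that commute with all
right translations. -/
def vnSubalgebra (Γ : Type) [Group Γ] : Subalgebra ℂ (ell2 Γ →L[ℂ] ell2 Γ) :=
  Subalgebra.centralizer ℂ
    (Set.range fun g : Γ => (ell2.perm (Equiv.mulRight g)).toContinuousLinearMap)

/-- The group von Neumann algebra `N(Γ)` as a type (with its ring structure only). -/
def GroupVN (Γ : Type) [Group Γ] : Type := vnSubalgebra Γ

instance GroupVN.instRing (Γ : Type) [Group Γ] : Ring (GroupVN Γ) :=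
  Subalgebra.toRing (vnSubalgebra Γ)

/-- The bounded operator on `ℓ²(Γ)` underlying an element of `N(Γ)`. -/
def GroupVN.toOperator {Γ : Type} [Group Γ] (a : GroupVN Γ) : ell2 Γ →L[ℂ] ell2 Γ :=
  (vnSubalgebra Γ).val a

/-- Left translation by `g`, as an element of `N(Γ)`. -/
def GroupVN.of {Γ : Type} [Group Γ] (g : Γ) : GroupVN Γ :=
  (⟨(ell2.perm (Equiv.mulLeft g)).toContinuousLinearMap, by
    rw [vnSubalgebra, Subalgebra.mem_centralizer_iff]
    rintro _ ⟨h, rfl⟩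
    ext f x
    change f ((Equiv.mulLeft g)⁻¹ ((Equiv.mulRight h)⁻¹ x)) =
      f ((Equiv.mulRight h)⁻¹ ((Equiv.mulLeft g)⁻¹ x))
    simp [mul_assoc]⟩ : vnSubalgebra Γ)

/-- The von Neumann trace `⟨a δ_1, δ_1⟩` on `N(Γ)`. -/
def vnTrace {Γ : Type} [Group Γ] (a : GroupVN Γ) : ℂ :=
  inner ℂ (ell2.delta (1 : Γ)) (a.toOperator (ell2.delta (1 : Γ)))

/-- The (extended) von Neumann dimension of an arbitrary left `N(Γ)`-module `M`: the supremum of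
the dimensions of the finitely generated projective submodules of `M`. Such a submodule is
isomorphic to the row space of an idempotent matrix `E`, and its dimension is the trace of `E`. -/
def vnDim (Γ : Type) [Group Γ] (M : Type) [AddCommGroup M] [Module (GroupVN Γ) M] : ENNReal :=
  ⨆ (k : ℕ) (E : Matrix (Fin k) (Fin k) (GroupVN Γ)) (_ : IsIdempotentElem E)
    (_ : ∃ f : LinearMap.range E.vecMulLinear →ₗ[GroupVN Γ] M, Function.Injective f),
    ENNReal.ofReal (∑ i, (vnTrace (E i i)).re)

/-- The differential of the (inhomogeneous) bar complex computing `H_*(Γ; N(Γ))`; the module in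
degree `m` is the free left `N(Γ)`-module on `Γ^m`. -/
def barDiff (Γ : Type) [Group Γ] (m : ℕ) :
    ((Fin (m + 1) → Γ) →₀ GroupVN Γ) →ₗ[GroupVN Γ] ((Fin m → Γ) →₀ GroupVN Γ) :=
  Finsupp.linearCombination (GroupVN Γ) fun g : Fin (m + 1) → Γ =>
    Finsupp.single (fun i => g i.succ) (GroupVN.of (g 0)) +
      ∑ j : Fin (m + 1), (-1 : ℤ) ^ ((j : ℕ) + 1) •
        Finsupp.single (Fin.contractNth j (· * ·) g) (1 : GroupVN Γ)

/-- The cycles of the bar complex. -/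
def barCycles (Γ : Type) [Group Γ] : (m : ℕ) → Submodule (GroupVN Γ) ((Fin m → Γ) →₀ GroupVN Γ)
  | 0 => ⊤
  | m + 1 => LinearMap.ker (barDiff Γ m)

/-- The `ℓ²`-homology `H_m(Γ; N(Γ))`, a left `N(Γ)`-module: the cycles modulo the boundaries,
formed inside the quotient of all chains by the boundaries. -/
abbrev l2Homology (Γ : Type) [Group Γ] (m : ℕ) : Type :=
  (barCycles Γ m).map (LinearMap.range (barDiff Γ m)).mkQ

/-- The `ℓ²`-Betti numbers of a group. -/
def l2Betti (Γ : Type) [Group Γ] (m : ℕ) : ENNReal := vnDim Γ (l2Homology Γ m)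

/-! ### Finiteness properties and the quantitative rank conjecture -/

/-- `Γ` is of type `FP_m` over `ℂ`: the trivial module `ℂ` has a projective resolution over
`ℂ[Γ]` that is finitely generated in degrees `≤ m`. -/
def IsTypeFP (Γ : Type) [Group Γ] (m : ℕ) : Prop :=
  ∃ P : CategoryTheory.ProjectiveResolution
      (ModuleCat.of (MonoidAlgebra ℂ Γ) (Representation.trivial ℂ Γ ℂ).asModule),
    ∀ j ≤ m, Module.Finite (MonoidAlgebra ℂ Γ) (P.complex.X j)

/-- The centre of `G` acts on `ρ` through the character `χ`. -/
def HasCentralCharacter {N : ℕ} {G : Subgroup (GL (Fin N) ℂ)} {W : Type} [AddCommGroup W]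
    [Module ℂ W] (ρ : Representation ℂ G W) (χ : Subgroup.center G →* ℂˣ) : Prop :=
  ∀ (z : Subgroup.center G) (w : W), ρ (z : G) w = (χ z : ℂ) • w

/-- The restriction to `Z(G) ∩ Γ` of a character of the centre of `G`. -/
def restrictCentral {G : Type} [Group G] (Γ : Subgroup G) (χ : Subgroup.center G →* ℂˣ) :
    (Subgroup.center G).subgroupOf Γ →* ℂˣ :=
  χ.comp ((Γ.subtype.comp ((Subgroup.center G).subgroupOf Γ).subtype).codRestrict
    (Subgroup.center G) fun z => z.2)

/-- The quantitative rank conjecture for the subgroup `Γ` of `G`: for every character `χ` of the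
centre of `G` and every matrix `A` over `ℂ[Γ]`, the rank of `A` on irreducible representations of
`G` with central character `χ` differs from the twisted von Neumann rank of `A` by
`O(1 / min λ_i)`. -/
def QuantitativeRankConjecture {N : ℕ} {G : Subgroup (GL (Fin N) ℂ)} {n : ℕ}
    (D : SimpleSystem G n) (Γ : Subgroup G) : Prop :=
  ∀ (χ : Subgroup.center G →* ℂˣ) (r s : ℕ) (A : Matrix (Fin r) (Fin s) (MonoidAlgebra ℂ Γ)),
    ∃ C : ℝ, ∀ (W : Type) [AddCommGroup W] [Module ℂ W] (ρ : Representation ℂ G W)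
      (l : Fin n → ℕ), IsIrrepOfWeight D ρ l → HasCentralCharacter ρ χ → 0 < ⨅ i, l i →
      |repRank (ρ.comp Γ.subtype) A -
        twistedRank ((Subgroup.center G).subgroupOf Γ) (restrictCentral Γ χ) A| ≤
          C / ((⨅ i, l i : ℕ) : ℝ)

/-- Some finite index subgroup of `Γ` satisfies the quantitative rank conjecture. -/
def VirtuallyQuantitativeRankConjecture {N : ℕ} {G : Subgroup (GL (Fin N) ℂ)} {n : ℕ}
    (D : SimpleSystem G n) (Γ : Subgroup G) : Prop :=
  ∃ Γ' : Subgroup G, Γ' ≤ Γ ∧ Γ'.relIndex Γ ≠ 0 ∧ QuantitativeRankConjecture D Γ'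

end SemisimpleGrowth

end

/-!
The cohomology is compared with the ranks of two matrices `T` and `A` over the group algebra of a
finite index subgroup `Γ'` that satisfies the rank conjecture.

Let `P` be a projective resolution of the trivial module that is finitely generated up to degree
`i + 1`, and let `C` be the cokernel of `P_{i+1} → P_i`. It is finitely presented, over `ℂ[Γ]` and
also over `ℂ[Γ']`, and the differential induces a map `d` from `C` to the finitely generated
projective module `P_{i-1}` (for `i = 0`, the zero map). A finite presentation of `C`, with `k`
generators and relation matrix `T`, and a matrix `A` of `d` (`MatrixPresentation`) describe the
`i`-cocycles with values in any `Γ'`-module `V` as the kernel of `T` on `V^k`, and the coboundaries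
as the image of `A`. Restriction from `Γ` to `Γ'` is injective on the cohomology with values in a
complex representation `W`, by averaging over cosets, so (`groupCohomology_bound`)
`dim H^i(Γ, W) ≤ dim ker T - rank A = k dim W - rank T - rank A` on `W`.

It remains to see that the von Neumann ranks of `T` and `A` over `Γ'` add up to `k`; the rank
conjecture, applied to `T` and `A`, then finishes the proof. Take first the corresponding matrices
over `Γ`. The space of harmonic cochains `ker T ∩ (im A)ᗮ` in `ℓ²(Γ)^k` is the image of an
idempotent matrix over the von Neumann algebra `N(Γ)`, and the row space of that matrix embeds into
`H_i(Γ; N(Γ))`. As `b_i^{(2)}(Γ) = 0`, the trace of the idempotent is zero, and faithfulness of the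
trace leaves no harmonic cochains (`harmonic_eq_bot`). So `ker T` is the closure of `im A`, and this
passes to `Γ'` because the `ℓ²`-space of `Γ` is coinduced from that of `Γ'`
(`ker_le_closure_range_of_finiteIndex`). By the rank–nullity theorem for the von Neumann dimension
(`trace_ker_add_trace_range`) the ranks of `T` and of `A` over `Γ'` add up to `k`.

The twist by central characters is harmless. The centre of a semi-simple group is finite
(`IsSemisimpleGroup.finite_center`): the identity component of the centre is trivial, and the
Zariski topology is Noetherian. So a torsion-free group meets the centre trivially, where the
twisted rank is the ordinary von Neumann rank (`twistedRank_bot`), and there are only finitely many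
central characters, over which the constants of the rank conjecture are summed.
-/

noncomputable section

namespace SemisimpleGrowth

/-! ### Comparison of projective resolutions with the bar resolution -/

section

open CategoryTheory

/-- The bar differential in degree `m + 1`, over any ring `S` with a homomorphism from `Γ` to its
multiplicative monoid. -/
def barDifferential {Γ : Type} [Group Γ] (S : Type) [Ring S] (u : Γ →* S) (m : ℕ) :
    ((Fin (m + 1) → Γ) →₀ S) →ₗ[S] ((Fin m → Γ) →₀ S) :=
  Finsupp.linearCombination S fun g : Fin (m + 1) → Γ =>
    Finsupp.single (fun i => g i.succ) (u (g 0)) +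
      ∑ j : Fin (m + 1), (-1 : ℤ) ^ ((j : ℕ) + 1) •
        Finsupp.single (Fin.contractNth j (· * ·) g) (1 : S)

/-- The differential of the bar complex leaving degree `m`. It is zero for `m = 0`, where the
target is the module in degree `0 - 1 = 0`. -/
def barBoundary {Γ : Type} [Group Γ] (S : Type) [Ring S] (u : Γ →* S) :
    (m : ℕ) → ((Fin m → Γ) →₀ S) →ₗ[S] ((Fin (m - 1) → Γ) →₀ S)
  | 0 => 0
  | m + 1 => barDifferential S u m

lemma barDifferential_single {Γ : Type} [Group Γ] (S : Type) [Ring S] (u : Γ →* S) (m : ℕ)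
    (g : Fin (m + 1) → Γ) :
    barDifferential S u m (Finsupp.single g 1) =
      Finsupp.single (fun i => g i.succ) (u (g 0)) +
        ∑ j : Fin (m + 1), (-1 : ℤ) ^ ((j : ℕ) + 1) •
          Finsupp.single (Fin.contractNth j (· * ·) g) (1 : S) := by
  simp only [barDifferential, Finsupp.linearCombination_single, one_smul]

instance (Γ : Type) [Group Γ] : (Rep.toModuleMonoidAlgebra (k := ℂ) (G := Γ)).Additive where
  map_add := rfl

/-- The bar resolution of the trivial module, as a resolution by modules over the group algebra. -/
def barModules (Γ : Type) [Group Γ] : ProjectiveResolution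
      (ModuleCat.of (MonoidAlgebra ℂ Γ) (Representation.trivial ℂ Γ ℂ).asModule) :=
  Rep.toModuleMonoidAlgebra.mapProjectiveResolution (Rep.barResolution ℂ Γ)

/-- The modules of the bar resolution are free on the tuples of group elements. -/
def barModulesEquiv (Γ : Type) [Group Γ] (m : ℕ) :
    (barModules Γ).complex.X m ≃ₗ[MonoidAlgebra ℂ Γ] ((Fin m → Γ) →₀ MonoidAlgebra ℂ Γ) :=
  show (Representation.free ℂ Γ (Fin m → Γ)).asModule ≃ₗ[MonoidAlgebra ℂ Γ] _ from
  (Representation.finsuppLEquivFreeAsModule ℂ Γ (Fin m → Γ)).symm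

lemma barModulesEquiv_d (Γ : Type) [Group Γ] (m : ℕ) (x : (barModules Γ).complex.X m) :
    barModulesEquiv Γ (m - 1) ((barModules Γ).complex.d m (m - 1) x) =
      barBoundary _ (MonoidAlgebra.of ℂ Γ) m (barModulesEquiv Γ m x) := by
  cases m with
  | zero =>
    rw [(barModules Γ).complex.shape _ _ (by simp)]
    simp [barBoundary]
  | succ m =>
    obtain ⟨y, rfl⟩ := (barModulesEquiv Γ (m + 1)).symm.surjective x
    rw [LinearEquiv.apply_symm_apply]
    suffices (barModulesEquiv Γ m).toLinearMap ∘ₗ ((barModules Γ).complex.d (m + 1) m).hom ∘ₗ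
        (barModulesEquiv Γ (m + 1)).symm.toLinearMap =
        barDifferential _ (MonoidAlgebra.of ℂ Γ) m from LinearMap.congr_fun this y
    apply Finsupp.lhom_ext'
    intro g
    apply LinearMap.ext_ring
    simp only [LinearMap.comp_apply, Finsupp.lsingle_apply]
    rw [barDifferential_single]
    have key : ((barModules Γ).complex.d (m + 1) m).hom
        ((barModulesEquiv Γ (m + 1)).symm.toLinearMap (Finsupp.single g 1)) =
        (barModulesEquiv Γ m).symm.toLinearMap ((Rep.barComplex.d ℂ Γ m).hom
          (Finsupp.single g (.single 1 1))) := by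
      rw [← Rep.barComplex.d_def]
      rfl
    rw [key, Rep.barComplex.d_single (k := ℂ)]
    refine (LinearEquiv.apply_symm_apply (barModulesEquiv Γ m) _).trans ?_
    congr 1
    refine Finset.sum_congr rfl fun j _ => ?_
    rcases Nat.even_or_odd ((j : ℕ) + 1) with h | h
    · simp [h.neg_one_pow, MonoidAlgebra.one_def]
    · simp [h.neg_one_pow, MonoidAlgebra.one_def, MonoidAlgebra.single_neg]

/-- Any projective resolution of the trivial module is homotopy equivalent to the bar resolution.
The equivalence and its homotopies are spelled out as linear maps in each degree; the terms with
`m - 1` vanish for `m = 0`, because the differentials leaving degree `0` do. -/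
theorem exists_comparison_bar (Γ : Type) [Group Γ] (P : ProjectiveResolution
      (ModuleCat.of (MonoidAlgebra ℂ Γ) (Representation.trivial ℂ Γ ℂ).asModule)) :
    ∃ (f : ∀ m, P.complex.X m →ₗ[MonoidAlgebra ℂ Γ] ((Fin m → Γ) →₀ MonoidAlgebra ℂ Γ))
      (g : ∀ m, ((Fin m → Γ) →₀ MonoidAlgebra ℂ Γ) →ₗ[MonoidAlgebra ℂ Γ] P.complex.X m),
      (∀ m x, barBoundary _ (MonoidAlgebra.of ℂ Γ) m (f m x) =
        f (m - 1) (P.complex.d m (m - 1) x)) ∧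
      (∀ m x, P.complex.d m (m - 1) (g m x) =
        g (m - 1) (barBoundary _ (MonoidAlgebra.of ℂ Γ) m x)) ∧
      (∀ m, ∃ (h : P.complex.X m →ₗ[MonoidAlgebra ℂ Γ] P.complex.X (m + 1))
          (h' : P.complex.X (m - 1) →ₗ[MonoidAlgebra ℂ Γ] P.complex.X m),
        ∀ x, g m (f m x) = P.complex.d (m + 1) m (h x) + h' (P.complex.d m (m - 1) x) + x) ∧
      (∀ m, ∃ (h : ((Fin m → Γ) →₀ MonoidAlgebra ℂ Γ) →ₗ[MonoidAlgebra ℂ Γ]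
            ((Fin (m + 1) → Γ) →₀ MonoidAlgebra ℂ Γ))
          (h' : ((Fin (m - 1) → Γ) →₀ MonoidAlgebra ℂ Γ) →ₗ[MonoidAlgebra ℂ Γ]
            ((Fin m → Γ) →₀ MonoidAlgebra ℂ Γ)),
        ∀ x, f m (g m x) = barDifferential _ (MonoidAlgebra.of ℂ Γ) m (h x) +
          h' (barBoundary _ (MonoidAlgebra.of ℂ Γ) m x) + x) := by
  let e := ProjectiveResolution.homotopyEquiv P (barModules Γ)
  let E := barModulesEquiv Γ
  have aux : ∀ (K : ChainComplex (ModuleCat (MonoidAlgebra ℂ Γ)) ℕ) (φ ψ : K ⟶ K)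
      (h : Homotopy φ ψ) (m : ℕ) (x : K.X m),
      φ.f m x = K.d (m + 1) m (h.hom m (m + 1) x) + h.hom (m - 1) m (K.d m (m - 1) x) +
        ψ.f m x := by
    intro K φ ψ h m x
    have := congrArg (fun k => k.hom x) (h.comm m)
    refine this.trans ?_
    have h1 : prevD m h.hom = h.hom m (m + 1) ≫ K.d (m + 1) m := prevD_eq _ (by simp)
    have h2 : dNext m h.hom = K.d m (m - 1) ≫ h.hom (m - 1) m := by
      cases m with
      | zero => simp [dNext]
      | succ m => exact dNext_eq _ (by simp)
    rw [h1, h2]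
    simp only [ModuleCat.hom_add, ModuleCat.hom_comp, LinearMap.add_apply, LinearMap.comp_apply]
    abel
  have hE : ∀ m x, E (m - 1) ((barModules Γ).complex.d m (m - 1) x) =
      barBoundary _ (MonoidAlgebra.of ℂ Γ) m (E m x) := barModulesEquiv_d Γ
  have hE' : ∀ m x, (barModules Γ).complex.d m (m - 1) ((E m).symm x) =
      (E (m - 1)).symm (barBoundary _ (MonoidAlgebra.of ℂ Γ) m x) := by
    intro m x
    rw [LinearEquiv.eq_symm_apply, hE, LinearEquiv.apply_symm_apply]
  have comm : ∀ (K L : ChainComplex (ModuleCat (MonoidAlgebra ℂ Γ)) ℕ) (φ : K ⟶ L) (m m' : ℕ)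
      (x : K.X m), L.d m m' (φ.f m x) = φ.f m' (K.d m m' x) := by
    intro K L φ m m' x
    exact congrArg (fun k => k.hom x) (φ.comm m m')
  refine ⟨fun m => (E m).toLinearMap ∘ₗ (e.hom.f m).hom,
    fun m => (e.inv.f m).hom ∘ₗ (E m).symm.toLinearMap, fun m x => ?_, fun m x => ?_,
    fun m => ?_, fun m => ?_⟩
  · simp only [LinearMap.comp_apply, LinearEquiv.coe_coe]
    rw [← hE, comm]
  · simp only [LinearMap.comp_apply, LinearEquiv.coe_coe]
    rw [comm, hE']
  · refine ⟨(e.homotopyHomInvId.hom m (m + 1)).hom, (e.homotopyHomInvId.hom (m - 1) m).hom,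
      fun x => ?_⟩
    simp only [LinearMap.comp_apply, LinearEquiv.coe_coe, LinearEquiv.symm_apply_apply]
    exact aux _ _ _ e.homotopyHomInvId m x
  · refine ⟨(E (m + 1)).toLinearMap ∘ₗ (e.homotopyInvHomId.hom m (m + 1)).hom ∘ₗ
        (E m).symm.toLinearMap, (E m).toLinearMap ∘ₗ (e.homotopyInvHomId.hom (m - 1) m).hom ∘ₗ
        (E (m - 1)).symm.toLinearMap, fun x => ?_⟩
    simp only [LinearMap.comp_apply, LinearEquiv.coe_coe]
    have h1 := aux _ _ _ e.homotopyInvHomId m ((E m).symm x)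
    have h2 := congrArg (E m) h1
    refine h2.trans ?_
    rw [map_add, map_add, hE']
    congr 1
    · congr 1
      exact hE (m + 1) _

end

/-! ### Matrices presenting a homomorphism of modules -/

/-- A description by matrices of a homomorphism `d : C → Q` from a finitely presented module to a
finitely generated projective module. For every module `V` it identifies `Hom(C, V)` with the kernel
of `rel` on column vectors over `V`, and the homomorphisms that factor through `d` with the image of
`mat`. -/
structure MatrixPresentation {R C Q : Type} [Ring R] [AddCommGroup C] [Module R C]
    [AddCommGroup Q] [Module R Q] (d : C →ₗ[R] Q) where
  /-- the number of generators of `C` -/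
  k : ℕ
  /-- the number of relations between the generators -/
  m : ℕ
  /-- the number of generators of `Q` -/
  l : ℕ
  /-- the generators of `C` -/
  gen : Fin k → C
  /-- the relations between the generators, as the rows of a matrix -/
  rel : Matrix (Fin m) (Fin k) R
  /-- the generators of `Q` -/
  genQ : Fin l → Q
  /-- a splitting of the surjection from the free module onto `Q` -/
  split : Q →ₗ[R] (Fin l → R)
  span_gen : ∀ x : C, ∃ r : Fin k → R, ∑ b, r b • gen b = x
  rel_iff : ∀ r : Fin k → R, ∑ b, r b • gen b = 0 ↔ ∃ w, Matrix.vecMul w rel = r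
  sum_split : ∀ x : Q, ∑ b, split x b • genQ b = x

namespace MatrixPresentation

section

variable {R C Q : Type} [Ring R] [AddCommGroup C] [Module R C] [AddCommGroup Q] [Module R Q]
  {d : C →ₗ[R] Q} (D : MatrixPresentation d)

/-- The matrix of `d` with respect to the generators of `C` and the splitting of `Q`. -/
def mat : Matrix (Fin D.k) (Fin D.l) R := Matrix.of fun a b => D.split (d (D.gen a)) b

lemma sum_mat (a : Fin D.k) : ∑ b, D.mat a b • D.genQ b = d (D.gen a) :=
  D.sum_split _

lemma sum_rel (a : Fin D.m) : ∑ b, D.rel a b • D.gen b = 0 :=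
  (D.rel_iff _).2 ⟨Pi.single a 1, by ext; simp⟩

lemma rel_mul_mat : D.rel * D.mat = 0 := by
  ext a b
  have h := congrArg (fun x => D.split (d x) b) (D.sum_rel a)
  simpa [map_sum, Matrix.mul_apply, mat] using h

end

theorem nonempty {R C Q : Type} [Ring R] [AddCommGroup C] [Module R C]
    [AddCommGroup Q] [Module R Q] (d : C →ₗ[R] Q) [Module.FinitePresentation R C]
    [Module.Finite R Q] [Module.Projective R Q] : Nonempty (MatrixPresentation d) := by
  obtain ⟨k, m, f, g, hf, hfg⟩ := Module.FinitePresentation.exists_fin' R C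
  obtain ⟨l, q, hq⟩ := Module.Finite.exists_fin' R Q
  obtain ⟨s, hs⟩ := Module.projective_lifting_property q LinearMap.id hq
  have expand : ∀ {n : ℕ} {M : Type} [AddCommGroup M] [Module R M] (φ : (Fin n → R) →ₗ[R] M)
      (r : Fin n → R), ∑ b, r b • φ (Pi.single b 1) = φ r := by
    intro n M _ _ φ r
    conv_rhs => rw [← Finset.univ_sum_single r]
    simp only [map_sum]
    refine Finset.sum_congr rfl fun b _ => ?_
    rw [← map_smul, ← Pi.single_smul, smul_eq_mul, mul_one]
  refine ⟨⟨k, m, l, fun b => f (Pi.single b 1), Matrix.of fun a b => g (Pi.single a 1) b,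
    fun b => q (Pi.single b 1), s, fun x => ?_, fun r => ?_, fun x => ?_⟩⟩
  · obtain ⟨r, rfl⟩ := hf x
    exact ⟨r, expand f r⟩
  · rw [expand, hfg r]
    refine exists_congr fun w => ?_
    rw [← expand g w]
    refine Eq.congr_left ?_
    ext b
    simp [Matrix.vecMul, dotProduct]
  · rw [expand]
    exact LinearMap.congr_fun hs x

variable {Γ V C Q : Type} [Group Γ] [AddCommGroup V] [Module ℂ V] (ρ : Representation ℂ Γ V)
  [AddCommGroup C] [Module (MonoidAlgebra ℂ Γ) C] [AddCommGroup Q] [Module (MonoidAlgebra ℂ Γ) Q]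
  {d : C →ₗ[MonoidAlgebra ℂ Γ] Q} (D : MatrixPresentation d)

lemma _root_.SemisimpleGrowth.matrixAction_apply {Γ V : Type} [Group Γ] [AddCommGroup V]
    [Module ℂ V] (ρ : Representation ℂ Γ V) {r s : ℕ}
    (A : Matrix (Fin r) (Fin s) (MonoidAlgebra ℂ Γ)) (v : Fin s → V) (i : Fin r) :
    matrixAction ρ A v i = ∑ j, ρ.asAlgebraHom (A i j) (v j) := by
  simp [matrixAction]

lemma _root_.SemisimpleGrowth.matrixAction_mul {Γ V : Type} [Group Γ] [AddCommGroup V]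
    [Module ℂ V] (ρ : Representation ℂ Γ V) {r s t : ℕ}
    (A : Matrix (Fin r) (Fin s) (MonoidAlgebra ℂ Γ))
    (B : Matrix (Fin s) (Fin t) (MonoidAlgebra ℂ Γ)) (v : Fin t → V) :
    matrixAction ρ A (matrixAction ρ B v) = matrixAction ρ (A * B) v := by
  ext i
  simp only [matrixAction_apply, Matrix.mul_apply, map_sum, map_mul, LinearMap.sum_apply,
    Module.End.mul_apply]
  exact Finset.sum_comm

lemma hom_mem_ker (φ : C →ₗ[MonoidAlgebra ℂ Γ] ρ.asModule) :
    (fun a => ρ.asModuleEquiv (φ (D.gen a))) ∈ LinearMap.ker (matrixAction ρ D.rel) := by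
  rw [LinearMap.mem_ker]
  ext a
  rw [matrixAction_apply]
  have h := congrArg (fun x => ρ.asModuleEquiv (φ x)) (D.sum_rel a)
  simpa [map_sum, Representation.asModuleEquiv_map_smul] using h

lemma exists_hom_of_mem_ker {v : Fin D.k → V} (hv : v ∈ LinearMap.ker (matrixAction ρ D.rel)) :
    ∃ φ : C →ₗ[MonoidAlgebra ℂ Γ] ρ.asModule, ∀ a, φ (D.gen a) = ρ.asModuleEquiv.symm (v a) := by
  classical
  let L : (Fin D.k → MonoidAlgebra ℂ Γ) →ₗ[MonoidAlgebra ℂ Γ] C :=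
    Fintype.linearCombination (MonoidAlgebra ℂ Γ) D.gen
  let M : (Fin D.k → MonoidAlgebra ℂ Γ) →ₗ[MonoidAlgebra ℂ Γ] ρ.asModule :=
    Fintype.linearCombination (MonoidAlgebra ℂ Γ) fun a => ρ.asModuleEquiv.symm (v a)
  have hL : Function.Surjective L := D.span_gen
  have hker : LinearMap.ker L ≤ LinearMap.ker M := by
    intro r hr
    obtain ⟨w, rfl⟩ := (D.rel_iff r).1 hr
    have hM : M (Matrix.vecMul w D.rel) =
        ∑ a, w a • ∑ b, D.rel a b • ρ.asModuleEquiv.symm (v b) := by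
      simp only [M, Fintype.linearCombination_apply, Matrix.vecMul, dotProduct, Finset.sum_smul,
        Finset.smul_sum, mul_smul]
      exact Finset.sum_comm
    rw [LinearMap.mem_ker, hM]
    refine Finset.sum_eq_zero fun a _ => ?_
    have h := congrFun hv a
    rw [matrixAction_apply] at h
    have h2 : ∑ b, D.rel a b • ρ.asModuleEquiv.symm (v b) = 0 := by
      apply ρ.asModuleEquiv.injective
      simpa [map_sum, Representation.asModuleEquiv_map_smul] using h
    rw [h2, smul_zero]
  refine ⟨(LinearMap.ker L).liftQ M hker ∘ₗ (L.quotKerEquivOfSurjective hL).symm.toLinearMap,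
    fun a => ?_⟩
  have h1 : L (Pi.single a 1) = D.gen a := by
    simp [L, Fintype.linearCombination_apply_single]
  rw [LinearMap.comp_apply, LinearEquiv.coe_coe, ← h1]
  have h2 : (L.quotKerEquivOfSurjective hL).symm (L (Pi.single a 1)) =
      Submodule.Quotient.mk (Pi.single a 1) := by
    rw [LinearEquiv.symm_apply_eq]
    rfl
  rw [h2]
  simp [M, Submodule.liftQ_apply, Fintype.linearCombination_apply_single]

lemma comp_mem_range (ψ : Q →ₗ[MonoidAlgebra ℂ Γ] ρ.asModule) :
    (fun a => ρ.asModuleEquiv (ψ (d (D.gen a)))) ∈ LinearMap.range (matrixAction ρ D.mat) := by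
  refine ⟨fun b => ρ.asModuleEquiv (ψ (D.genQ b)), ?_⟩
  ext a
  rw [matrixAction_apply, ← D.sum_mat a]
  simp [map_sum, Representation.asModuleEquiv_map_smul]

lemma exists_comp_of_mem_range {v : Fin D.k → V}
    (hv : v ∈ LinearMap.range (matrixAction ρ D.mat)) :
    ∃ ψ : Q →ₗ[MonoidAlgebra ℂ Γ] ρ.asModule,
      ∀ a, ψ (d (D.gen a)) = ρ.asModuleEquiv.symm (v a) := by
  obtain ⟨w, rfl⟩ := hv
  refine ⟨Fintype.linearCombination (MonoidAlgebra ℂ Γ)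
    (fun b => ρ.asModuleEquiv.symm (w b)) ∘ₗ D.split, fun a => ?_⟩
  rw [LinearEquiv.eq_symm_apply, matrixAction_apply, LinearMap.comp_apply,
    Fintype.linearCombination_apply]
  simp [map_sum, Representation.asModuleEquiv_map_smul, mat]

lemma hom_ext {M : Type} [AddCommGroup M] [Module (MonoidAlgebra ℂ Γ) M]
    {φ ψ : C →ₗ[MonoidAlgebra ℂ Γ] M} (h : ∀ a, φ (D.gen a) = ψ (D.gen a)) : φ = ψ := by
  ext x
  obtain ⟨r, rfl⟩ := D.span_gen x
  simp [map_sum, h]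

end MatrixPresentation

/-! ### Inhomogeneous cochains and averaging over cosets -/

section

open CategoryTheory

/-- An additive map that commutes with scalars and with group elements is linear over the group
algebra. -/
def linearOfEquivariant {Γ M N : Type} [Group Γ] [AddCommGroup M] [Module (MonoidAlgebra ℂ Γ) M]
    [AddCommGroup N] [Module (MonoidAlgebra ℂ Γ) N] (ψ : M →+ N)
    (h : ∀ (g : Γ) (c : ℂ) x, ψ (MonoidAlgebra.single g c • x) = MonoidAlgebra.single g c • ψ x) :
    M →ₗ[MonoidAlgebra ℂ Γ] N where
  toFun := ψ
  map_add' := map_add ψ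
  map_smul' a x := by
    induction a using MonoidAlgebra.induction_linear with
    | zero => simp
    | add a b ha hb => rw [add_smul, map_add, ha, hb, RingHom.id_apply, RingHom.id_apply,
        RingHom.id_apply, add_smul]
    | single g c => exact h g c x

/-- Averaging over the cosets of a subgroup of finite index turns a homomorphism for the subgroup
into a homomorphism for the whole group, without changing it at the points where it is already
equivariant. -/
theorem exists_average {Γ Γ' W Q : Type} [Group Γ] [Group Γ'] (j : Γ' →* Γ) [j.range.FiniteIndex]
    [AddCommGroup W] [Module ℂ W] (ρ : Representation ℂ Γ W) [AddCommGroup Q]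
    [Module (MonoidAlgebra ℂ Γ) Q] (ψ : Q →+ W)
    (hψ : ∀ (g : Γ') (c : ℂ) q,
      ψ (MonoidAlgebra.single (j g) c • q) = c • ρ (j g) (ψ q)) :
    ∃ φ : Q →ₗ[MonoidAlgebra ℂ Γ] ρ.asModule, ∀ q,
      (∀ g : Γ, ψ (MonoidAlgebra.single g (1 : ℂ) • q) = ρ g (ψ q)) →
        φ q = ρ.asModuleEquiv.symm (ψ q) := by
  classical
  have : Fintype (Γ ⧸ j.range) := Fintype.ofFinite _
  have hc : ∀ (c : ℂ) q, ψ (MonoidAlgebra.single (1 : Γ) c • q) = c • ψ q := fun c q => by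
    simpa using hψ 1 c q
  let F : Γ → Q → W := fun g q => ρ g (ψ (MonoidAlgebra.single g⁻¹ (1 : ℂ) • q))
  have hF : ∀ a b : Γ, (QuotientGroup.leftRel j.range) a b → F a = F b := by
    intro a b hab
    obtain ⟨x, hx⟩ := QuotientGroup.leftRel_apply.1 hab
    obtain rfl : b = a * j x := by rw [hx]; group
    funext q
    have h1 := hψ x⁻¹ 1 (MonoidAlgebra.single a⁻¹ (1 : ℂ) • q)
    rw [← mul_smul, MonoidAlgebra.single_mul_single] at h1
    simp only [F, mul_inv_rev]
    rw [map_inv, mul_one] at h1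
    rw [h1, map_mul, one_smul, Module.End.mul_apply, ← Module.End.mul_apply (ρ (j x)), ← map_mul]
    simp
  -- the conjugates of `ψ` depend only on the coset
  let F' : Γ ⧸ j.range → Q → W := fun t => Quotient.lift F hF t
  have hF' : ∀ (t : Γ ⧸ j.range) (g : Γ) (c : ℂ) (q : Q),
      F' (g • t) (MonoidAlgebra.single g c • q) = c • ρ g (F' t q) := by
    intro t g c q
    induction t using Quotient.inductionOn with
    | h a =>
      change F (g * a) (MonoidAlgebra.single g c • q) = c • ρ g (F a q)
      simp only [F, mul_inv_rev]
      rw [← mul_smul, MonoidAlgebra.single_mul_single, map_mul, Module.End.mul_apply, ← map_smul,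
        ← map_smul, ← hc, ← mul_smul, MonoidAlgebra.single_mul_single]
      simp
  have hadd : ∀ t x y, F' t (x + y) = F' t x + F' t y := by
    intro t x y
    induction t using Quotient.inductionOn with
    | h a => change F a _ = F a _ + F a _; simp [F]
  have hfix : ∀ t q, (∀ g : Γ, ψ (MonoidAlgebra.single g (1 : ℂ) • q) = ρ g (ψ q)) →
      F' t q = ψ q := by
    intro t q hq
    induction t using Quotient.inductionOn with
    | h a =>
      change F a q = _
      simp only [F]
      rw [hq, ← Module.End.mul_apply, ← map_mul]
      simp
  have hn : ((Fintype.card (Γ ⧸ j.range) : ℕ) : ℂ) ≠ 0 := Nat.cast_ne_zero.2 Fintype.card_ne_zero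
  let S : Q →+ ρ.asModule :=
    { toFun := fun q => ρ.asModuleEquiv.symm
        (((Fintype.card (Γ ⧸ j.range) : ℕ) : ℂ)⁻¹ • ∑ t, F' t q)
      map_zero' := by
        have h0 : ∀ t, F' t 0 = 0 := fun t => by simpa using hadd t 0 0
        simp [h0]
      map_add' := fun x y => by simp [hadd, Finset.sum_add_distrib] }
  refine ⟨linearOfEquivariant S fun g c x => ?_, fun q hq => ?_⟩
  · apply ρ.asModuleEquiv.injective
    rw [Representation.asModuleEquiv_map_smul]
    change ((Fintype.card (Γ ⧸ j.range) : ℕ) : ℂ)⁻¹ • ∑ t, F' t (MonoidAlgebra.single g c • x) =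
      ρ.asAlgebraHom (MonoidAlgebra.single g c)
        (((Fintype.card (Γ ⧸ j.range) : ℕ) : ℂ)⁻¹ • ∑ t, F' t x)
    rw [map_smul]
    congr 1
    rw [Representation.asAlgebraHom_single, LinearMap.smul_apply, map_sum, Finset.smul_sum,
      ← Equiv.sum_comp (MulAction.toPerm g)]
    exact Finset.sum_congr rfl fun t _ => hF' t g c x
  · change ρ.asModuleEquiv.symm (((Fintype.card (Γ ⧸ j.range) : ℕ) : ℂ)⁻¹ • ∑ t, F' t q) = _
    congr 1
    rw [Finset.sum_congr rfl fun t _ => hfix t q hq, Finset.sum_const, Finset.card_univ,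
      ← Nat.cast_smul_eq_nsmul ℂ, smul_smul, inv_mul_cancel₀ hn, one_smul]

/-- The homomorphism from a module of the bar resolution that an inhomogeneous cochain
determines. -/
def cochainLift {Γ W : Type} [Group Γ] [AddCommGroup W] [Module ℂ W] (ρ : Representation ℂ Γ W)
    {m : ℕ} (c : (Fin m → Γ) → W) :
    ((Fin m → Γ) →₀ MonoidAlgebra ℂ Γ) →ₗ[MonoidAlgebra ℂ Γ] ρ.asModule :=
  Finsupp.linearCombination _ fun g => ρ.asModuleEquiv.symm (c g)

section

variable {Γ W : Type} [Group Γ] [AddCommGroup W] [Module ℂ W] (ρ : Representation ℂ Γ W)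

lemma cochainLift_single {m : ℕ} (c : (Fin m → Γ) → W) (g : Fin m → Γ) :
    cochainLift ρ c (Finsupp.single g 1) = ρ.asModuleEquiv.symm (c g) := by
  simp [cochainLift]

lemma asModuleEquiv_cochainLift {m : ℕ} (c : (Fin m → Γ) → W)
    (y : (Fin m → Γ) →₀ MonoidAlgebra ℂ Γ) :
    ρ.asModuleEquiv (cochainLift ρ c y) = y.sum fun g r => ρ.asAlgebraHom r (c g) := by
  simp [cochainLift, Finsupp.linearCombination_apply, Finsupp.sum, map_sum,
    Representation.asModuleEquiv_map_smul]

/-- Evaluation of cochains at a fixed chain of the bar resolution. -/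
def evalCochain {m : ℕ} (y : (Fin m → Γ) →₀ MonoidAlgebra ℂ Γ) : ((Fin m → Γ) → W) →ₗ[ℂ] W where
  toFun c := ρ.asModuleEquiv (cochainLift ρ c y)
  map_add' c c' := by simp [asModuleEquiv_cochainLift, Finsupp.sum, Finset.sum_add_distrib]
  map_smul' a c := by simp [asModuleEquiv_cochainLift, Finsupp.sum, Finset.smul_sum]

lemma cochainLift_d {m : ℕ} (c : (Fin m → Γ) → W) :
    cochainLift ρ (inhomogeneousCochains.d (Rep.of ρ) m c) =
      cochainLift ρ c ∘ₗ barDifferential _ (MonoidAlgebra.of ℂ Γ) m := by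
  apply Finsupp.lhom_ext'
  intro g
  apply LinearMap.ext_ring
  apply ρ.asModuleEquiv.injective
  simp only [LinearMap.comp_apply, Finsupp.lsingle_apply]
  rw [barDifferential_single, cochainLift_single, map_add, map_sum, map_add, map_sum,
    LinearEquiv.apply_symm_apply, inhomogeneousCochains.d_hom_apply]
  congr 1
  · simp [asModuleEquiv_cochainLift]
  · refine Finset.sum_congr rfl fun j _ => ?_
    rw [map_zsmul, cochainLift_single, map_zsmul, LinearEquiv.apply_symm_apply,
      ← Int.cast_smul_eq_zsmul ℂ]
    simp

end

end

/-! ### Group cohomology through a projective resolution -/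

section

open CategoryTheory

/-- The cokernel of the differential into degree `m` of a complex of modules: homomorphisms out of
it are the `m`-cocycles of the dual complexes. -/
abbrev cokernelModule {R : Type} [Ring R] (K : ChainComplex (ModuleCat.{0} R) ℕ) (m : ℕ) : Type :=
  K.X m ⧸ LinearMap.range (K.d (m + 1) m).hom

/-- The map that the differential leaving degree `m` induces on `cokernelModule K m`. It is
zero for `m = 0`, where the target is the module in degree `0 - 1 = 0`. -/
def cokernelDiff {R : Type} [Ring R] (K : ChainComplex (ModuleCat.{0} R) ℕ) (m : ℕ) :
    cokernelModule K m →ₗ[R] K.X (m - 1) :=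
  Submodule.liftQ _ (K.d m (m - 1)).hom (by
    rintro _ ⟨x, rfl⟩
    exact congrArg (fun f => f.hom x) (K.d_comp_d (m + 1) m (m - 1)))

/-- If cocycles `Z` are mapped to a subspace `K` of `V` in such a way that those landing in `U` are
coboundaries, then the cohomology `H` is no larger than `K / U`. -/
lemma finrank_add_finrank_le {Z H V : Type} [AddCommGroup Z] [Module ℂ Z] [AddCommGroup H]
    [Module ℂ H] [AddCommGroup V] [Module ℂ V] [FiniteDimensional ℂ V] (π : Z →ₗ[ℂ] H)
    (hπ : Function.Surjective π) (θ : Z →ₗ[ℂ] V) (U K : Submodule ℂ V) (hUK : U ≤ K)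
    (hθ : ∀ z, θ z ∈ K) (hker : ∀ z, θ z ∈ U → π z = 0) :
    FiniteDimensional ℂ H ∧ Module.finrank ℂ H + Module.finrank ℂ U ≤ Module.finrank ℂ K := by
  let θ' : Z →ₗ[ℂ] K := θ.codRestrict K hθ
  let U' : Submodule ℂ K := U.comap K.subtype
  let Θ : Z →ₗ[ℂ] (K ⧸ U') := U'.mkQ ∘ₗ θ'
  have hle : LinearMap.ker Θ ≤ LinearMap.ker π := by
    intro z hz
    refine hker z ?_
    have : U'.mkQ (θ' z) = 0 := hz
    rw [Submodule.mkQ_apply, Submodule.Quotient.mk_eq_zero] at this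
    exact this
  let q : LinearMap.range Θ →ₗ[ℂ] H :=
    (LinearMap.ker Θ).liftQ π hle ∘ₗ Θ.quotKerEquivRange.symm.toLinearMap
  have hq : Function.Surjective q := by
    intro h
    obtain ⟨z, rfl⟩ := hπ h
    refine ⟨Θ.quotKerEquivRange (Submodule.Quotient.mk z), ?_⟩
    simp [q]
  have hfd : FiniteDimensional ℂ H := Module.Finite.of_surjective q hq
  refine ⟨hfd, ?_⟩
  have h1 : Module.finrank ℂ H ≤ Module.finrank ℂ (LinearMap.range Θ) :=
    LinearMap.finrank_le_finrank_of_surjective hq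
  have h2 : Module.finrank ℂ (LinearMap.range Θ) ≤ Module.finrank ℂ (K ⧸ U') :=
    Submodule.finrank_le _
  have h3 := Submodule.finrank_quotient_add_finrank U'
  have h4 : Module.finrank ℂ U' = Module.finrank ℂ U :=
    (Submodule.comapSubtypeEquivOfLe hUK).finrank_eq
  omega

/-- Group cohomology is bounded by the cohomology of a projective resolution over the group algebra
of a subgroup of finite index. The restriction map from the cohomology of the group is injective by
averaging, and the bar resolution is compared with the given one. -/
theorem groupCohomology_bound {Γ Γ' W : Type} [Group Γ] [Group Γ'] (j : Γ' →* Γ)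
    [j.range.FiniteIndex] (P : ProjectiveResolution
      (ModuleCat.of (MonoidAlgebra ℂ Γ) (Representation.trivial ℂ Γ ℂ).asModule)) (i : ℕ)
    [Module (MonoidAlgebra ℂ Γ') (cokernelModule P.complex i)]
    [Module (MonoidAlgebra ℂ Γ') (P.complex.X (i - 1))]
    (hC : ∀ (g : Γ') (c : ℂ) (x : cokernelModule P.complex i),
      MonoidAlgebra.single g c • x = MonoidAlgebra.single (j g) c • x)
    (hQ : ∀ (g : Γ') (c : ℂ) (x : P.complex.X (i - 1)),
      MonoidAlgebra.single g c • x = MonoidAlgebra.single (j g) c • x)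
    (d : cokernelModule P.complex i →ₗ[MonoidAlgebra ℂ Γ'] P.complex.X (i - 1))
    (hd : ∀ x, d x = cokernelDiff P.complex i x) (D : MatrixPresentation d)
    [AddCommGroup W] [Module ℂ W] [FiniteDimensional ℂ W] (ρ : Representation ℂ Γ W)
    (σ : Representation ℂ Γ' W) (hσ : ∀ g, σ g = ρ (j g)) :
    FiniteDimensional ℂ (groupCohomology (Rep.of ρ) i) ∧
      Module.finrank ℂ (groupCohomology (Rep.of ρ) i) +
        Module.finrank ℂ (LinearMap.range (matrixAction σ D.mat)) ≤
      Module.finrank ℂ (LinearMap.ker (matrixAction σ D.rel)) := by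
  obtain ⟨f, g, hf, hg, -, hh⟩ := exists_comparison_bar Γ P
  obtain ⟨h, h', hh⟩ := hh i
  choose x hx using fun a => Submodule.mkQ_surjective _ (D.gen a)
  let K := groupCohomology.inhomogeneousCochains (Rep.of ρ)
  let ι : groupCohomology.cocycles (Rep.of ρ) i →ₗ[ℂ] ((Fin i → Γ) → W) :=
    (groupCohomology.iCocycles (Rep.of ρ) i).hom
  let θ : groupCohomology.cocycles (Rep.of ρ) i →ₗ[ℂ] (Fin D.k → W) :=
    LinearMap.pi fun a => evalCochain ρ (f i (x a)) ∘ₗ ι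
  have hcoc : ∀ z y, cochainLift ρ (ι z) (barDifferential _ (MonoidAlgebra.of ℂ Γ) i y) = 0 := by
    intro z y
    rw [← LinearMap.comp_apply, ← cochainLift_d]
    have : inhomogeneousCochains.d (Rep.of ρ) i (ι z) = 0 := by
      have h1 := congrArg (fun k => k.hom z) (K.iCycles_d i (i + 1))
      rw [groupCohomology.inhomogeneousCochains.d_def] at h1
      exact h1
    rw [this]
    exact ρ.asModuleEquiv.injective (map_zero (evalCochain ρ y))
  -- the homomorphism out of the cokernel that a cocycle determines
  have hfac : ∀ z, ∃ φ : cokernelModule P.complex i →ₗ[MonoidAlgebra ℂ Γ] ρ.asModule,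
      ∀ y, φ (Submodule.mkQ _ y) = cochainLift ρ (ι z) (f i y) := by
    intro z
    refine ⟨Submodule.liftQ _ (cochainLift ρ (ι z) ∘ₗ f i) ?_, fun y => rfl⟩
    rintro _ ⟨y, rfl⟩
    have h1 := hf (i + 1) y
    rw [LinearMap.mem_ker, LinearMap.comp_apply]
    exact (congrArg _ h1.symm).trans (hcoc z _)
  have hres : ∀ (g : Γ') (c : ℂ) (w : W), ρ.asAlgebraHom (MonoidAlgebra.single (j g) c) w =
      σ.asAlgebraHom (MonoidAlgebra.single g c) w := by
    intro g c w
    simp [Representation.asAlgebraHom_single, hσ]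
  have hrestrict : ∀ φ : cokernelModule P.complex i →ₗ[MonoidAlgebra ℂ Γ] ρ.asModule,
      ∃ φ' : cokernelModule P.complex i →ₗ[MonoidAlgebra ℂ Γ'] σ.asModule,
        ∀ y, σ.asModuleEquiv (φ' y) = ρ.asModuleEquiv (φ y) := by
    intro φ
    refine ⟨linearOfEquivariant ((σ.asModuleEquiv.symm.toAddEquiv.toAddMonoidHom.comp
        ρ.asModuleEquiv.toAddEquiv.toAddMonoidHom).comp φ.toAddMonoidHom) fun g c y => ?_,
        fun y => rfl⟩
    apply σ.asModuleEquiv.injective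
    rw [Representation.asModuleEquiv_map_smul, hC]
    change ρ.asModuleEquiv (φ (MonoidAlgebra.single (j g) c • y)) =
      σ.asAlgebraHom (MonoidAlgebra.single g c) (ρ.asModuleEquiv (φ y))
    rw [map_smul, Representation.asModuleEquiv_map_smul, hres]
  refine finrank_add_finrank_le (groupCohomology.π (Rep.of ρ) i).hom ?_ θ
    (LinearMap.range (matrixAction σ D.mat))
    (LinearMap.ker (matrixAction σ D.rel)) ?_ ?_ ?_
  · exact fun y => groupCohomology_induction_on y fun z => ⟨z, rfl⟩
  · rintro _ ⟨w, rfl⟩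
    rw [LinearMap.mem_ker, matrixAction_mul, D.rel_mul_mat]
    ext
    simp [matrixAction_apply]
  · intro z
    obtain ⟨φ, hφ⟩ := hfac z
    obtain ⟨φ', hφ'⟩ := hrestrict φ
    have h1 := D.hom_mem_ker σ φ'
    convert h1 using 1
    funext a
    rw [hφ', ← hx, hφ]
    rfl
  · intro z hz
    obtain ⟨φ, hφ⟩ := hfac z
    obtain ⟨ψ, hψ⟩ := D.exists_comp_of_mem_range σ hz
    let ψ' : P.complex.X (i - 1) →+ W :=
      σ.asModuleEquiv.toAddEquiv.toAddMonoidHom.comp ψ.toAddMonoidHom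
    have hψ' : ∀ (g : Γ') (c : ℂ) q,
        ψ' (MonoidAlgebra.single (j g) c • q) = c • ρ (j g) (ψ' q) := by
      intro g c q
      change σ.asModuleEquiv (ψ (MonoidAlgebra.single (j g) c • q)) = _
      rw [← hQ, map_smul, Representation.asModuleEquiv_map_smul, ← hres,
        Representation.asAlgebraHom_single]
      rfl
    obtain ⟨χ, hχ⟩ := exists_average j ρ ψ' hψ'
    -- the two homomorphisms agree on generators over the smaller group algebra
    have hagree : ∀ y : cokernelModule P.complex i,
        ρ.asModuleEquiv (φ y) = ψ' (cokernelDiff P.complex i y) := by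
      intro y
      obtain ⟨φ', hφ'⟩ := hrestrict φ
      have h1 : φ' = ψ ∘ₗ d := D.hom_ext fun a => by
        rw [LinearMap.comp_apply, hψ, LinearEquiv.eq_symm_apply, hφ', ← hx, hφ]
        rfl
      rw [← hφ', h1, ← hd]
      rfl
    have hχ' : ∀ y : P.complex.X i, χ (P.complex.d i (i - 1) y) =
        cochainLift ρ (ι z) (f i y) := by
      intro y
      have h1 : ∀ u : cokernelModule P.complex i, χ (cokernelDiff P.complex i u) = φ u := by
        intro u
        rw [hχ]
        · rw [← hagree, LinearEquiv.symm_apply_apply]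
        · intro γ
          rw [← map_smul, ← hagree, ← hagree, map_smul, Representation.asModuleEquiv_map_smul]
          simp [Representation.asAlgebraHom_single]
      rw [← hφ, ← h1]
      rfl
    let β : ((Fin (i - 1) → Γ) →₀ MonoidAlgebra ℂ Γ) →ₗ[MonoidAlgebra ℂ Γ] ρ.asModule :=
      χ ∘ₗ g (i - 1) - cochainLift ρ (ι z) ∘ₗ h'
    have hβ : ∀ y, cochainLift ρ (ι z) y = β (barBoundary _ (MonoidAlgebra.of ℂ Γ) i y) := by
      intro y
      have h1 := congrArg (cochainLift ρ (ι z)) (hh y)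
      rw [← hχ', hg, map_add, map_add, hcoc, zero_add] at h1
      simp only [β, LinearMap.sub_apply, LinearMap.comp_apply]
      rw [h1]
      abel
    have hzero : ∀ c c' : (Fin i → Γ) → W, cochainLift ρ c = cochainLift ρ c' → c = c' := by
      intro c c' hcc
      funext γ
      have h1 := LinearMap.congr_fun hcc (Finsupp.single γ 1)
      rwa [cochainLift_single, cochainLift_single, ρ.asModuleEquiv.symm.injective.eq_iff] at h1
    have hmono : Function.Injective ι := (ModuleCat.mono_iff_injective _).1 inferInstance
    cases i with
    | zero =>
      have h1 : z = 0 := by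
        apply hmono
        rw [map_zero]
        apply hzero
        refine LinearMap.ext fun y => (hβ y).trans ?_
        exact (map_zero β).trans (ρ.asModuleEquiv.injective (map_zero (evalCochain ρ y))).symm
      rw [h1, map_zero]
    | succ m =>
      let b : (Fin m → Γ) → W := fun γ => ρ.asModuleEquiv (β (Finsupp.single γ 1))
      have hb : cochainLift ρ b = β := by
        apply Finsupp.lhom_ext'
        intro γ
        apply LinearMap.ext_ring
        simp only [LinearMap.comp_apply, Finsupp.lsingle_apply]
        rw [cochainLift_single, LinearEquiv.symm_apply_apply]
      have h1 : z = groupCohomology.toCocycles (Rep.of ρ) m (m + 1) b := by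
        apply hmono
        have h2 : ι (groupCohomology.toCocycles (Rep.of ρ) m (m + 1) b) =
            inhomogeneousCochains.d (Rep.of ρ) m b := by
          have h3 := congrArg (fun k => k.hom b) (K.toCycles_i m (m + 1))
          rw [groupCohomology.inhomogeneousCochains.d_def] at h3
          exact h3
        rw [h2]
        apply hzero
        rw [cochainLift_d, hb]
        exact LinearMap.ext hβ
      rw [h1]
      exact congrArg (fun k => k.hom b) (K.toCycles_comp_homologyπ m (m + 1))

end

/-! ### The trace on equivariant operators -/

/-- The Hilbert space `ℓ²(Γ)^k`. -/
abbrev HilbertPow (Γ : Type) (k : ℕ) : Type := PiLp 2 fun _ : Fin k => ell2 Γ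

namespace HilbertPow

variable {Γ : Type}

/-- The vector `δ_g` in the coordinate `i`. -/
def basisVec {k : ℕ} (i : Fin k) (g : Γ) : HilbertPow Γ k :=
  PiLp.single 2 (β := fun _ : Fin k => ell2 Γ) i (ell2.delta g)

lemma _root_.SemisimpleGrowth.ell2.inner_delta_left (g : Γ) (f : ell2 Γ) :
    inner ℂ (ell2.delta g) f = f g := by
  classical
  rw [ell2.delta, lp.inner_single_left]
  simp

lemma _root_.SemisimpleGrowth.ell2.perm_delta (σ : Equiv.Perm Γ) (g : Γ) :
    ell2.perm σ (ell2.delta g) = ell2.delta (σ g) := by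
  classical
  ext x
  rw [ell2.perm_apply, ell2.delta, ell2.delta, lp.single_apply, lp.single_apply]
  by_cases h : x = σ g
  · subst h; simp
  · rw [Pi.single_eq_of_ne h, Pi.single_eq_of_ne]
    intro h'
    exact h (by rw [← h']; simp)

lemma inner_basisVec_left {k : ℕ} (i : Fin k) (g : Γ) (v : HilbertPow Γ k) :
    inner ℂ (basisVec i g) v = v i g := by
  rw [PiLp.inner_apply, Finset.sum_eq_single i]
  · rw [basisVec, PiLp.single_eq_same, ell2.inner_delta_left]
  · intro b _ hb
    rw [basisVec, PiLp.single_eq_of_ne _ hb, inner_zero_left]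
  · simp

lemma inner_eq_sum_tsum {k : ℕ} (u v : HilbertPow Γ k) :
    inner ℂ u v = ∑ i, ∑' g, inner ℂ u (basisVec i g) * inner ℂ (basisVec i g) v := by
  rw [PiLp.inner_apply]
  refine Finset.sum_congr rfl fun i _ => ?_
  rw [lp.inner_eq_tsum]
  refine tsum_congr fun g => ?_
  rw [← inner_conj_symm u, inner_basisVec_left, inner_basisVec_left]
  simp [mul_comm]

lemma ext_coord {k : ℕ} {u v : HilbertPow Γ k} (h : ∀ i g, u i g = v i g) : u = v := by
  ext i g
  exact h i g

variable [Group Γ]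

/-- Right translation by `g` in all coordinates of `ℓ²(Γ)^k`: it sends `δ_h` to `δ_(hg)`. -/
def rightShift {k : ℕ} (g : Γ) (v : HilbertPow Γ k) : HilbertPow Γ k :=
  WithLp.toLp 2 fun i => ell2.perm (Equiv.mulRight g) (v i)

lemma rightShift_apply {k : ℕ} (g : Γ) (v : HilbertPow Γ k) (i : Fin k) :
    rightShift g v i = ell2.perm (Equiv.mulRight g) (v i) := rfl

lemma rightShift_apply_apply {k : ℕ} (g : Γ) (v : HilbertPow Γ k) (i : Fin k) (h : Γ) :
    rightShift g v i h = v i (h * g⁻¹) := rfl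

lemma rightShift_basisVec {k : ℕ} (g h : Γ) (i : Fin k) :
    rightShift g (basisVec i h) = basisVec i (h * g) := by
  ext1 j
  rw [rightShift_apply]
  by_cases hj : j = i
  · subst hj
    rw [basisVec, basisVec, PiLp.single_eq_same, PiLp.single_eq_same, ell2.perm_delta]
    rfl
  · rw [basisVec, basisVec, PiLp.single_eq_of_ne _ hj, PiLp.single_eq_of_ne _ hj, map_zero]

lemma rightShift_rightShift {k : ℕ} (g h : Γ) (v : HilbertPow Γ k) :
    rightShift g (rightShift h v) = rightShift (h * g) v := by
  refine ext_coord fun i x => ?_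
  simp [rightShift_apply_apply, mul_assoc]

lemma rightShift_one {k : ℕ} (v : HilbertPow Γ k) : rightShift (1 : Γ) v = v :=
  ext_coord fun i x => by simp [rightShift_apply_apply]

lemma inner_rightShift {k : ℕ} (g : Γ) (u v : HilbertPow Γ k) :
    inner ℂ (rightShift g u) (rightShift g v) = inner ℂ u v := by
  simp [PiLp.inner_apply, rightShift_apply]

lemma inner_rightShift_left {k : ℕ} (g : Γ) (u v : HilbertPow Γ k) :
    inner ℂ (rightShift g u) v = inner ℂ u (rightShift g⁻¹ v) := by
  rw [← inner_rightShift g u, rightShift_rightShift]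
  simp [rightShift_one]

lemma rightShift_sub {k : ℕ} (g : Γ) (u v : HilbertPow Γ k) :
    rightShift g (u - v) = rightShift g u - rightShift g v := rfl

lemma rightShift_smul {k : ℕ} (g : Γ) (c : ℂ) (v : HilbertPow Γ k) :
    rightShift g (c • v) = c • rightShift g v := rfl

/-- Operators that commute with all right translations. -/
def IsEquivariant {k l : ℕ} (T : HilbertPow Γ k →L[ℂ] HilbertPow Γ l) : Prop :=
  ∀ (g : Γ) (v : HilbertPow Γ k), T (rightShift g v) = rightShift g (T v)

/-- The trace `∑ ⟨T e_i, e_i⟩` of an operator on `ℓ²(Γ)^k`, where `e_i` is `δ_1` in the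
coordinate `i`. -/
def trace {k : ℕ} (T : HilbertPow Γ k →L[ℂ] HilbertPow Γ k) : ℂ :=
  ∑ i, inner ℂ (basisVec i (1 : Γ)) (T (basisVec i 1))

namespace IsEquivariant

variable {k l m : ℕ}

lemma comp {T : HilbertPow Γ l →L[ℂ] HilbertPow Γ m} {S : HilbertPow Γ k →L[ℂ] HilbertPow Γ l}
    (hT : IsEquivariant T) (hS : IsEquivariant S) : IsEquivariant (T ∘L S) := fun g v => by
  simp [hS g, hT g]

lemma one : IsEquivariant (1 : HilbertPow Γ k →L[ℂ] HilbertPow Γ k) := fun _ _ => rfl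

lemma sub {T S : HilbertPow Γ k →L[ℂ] HilbertPow Γ l}
    (hT : IsEquivariant T) (hS : IsEquivariant S) : IsEquivariant (T - S) := fun g v => by
  simp [hS g, hT g, rightShift_sub]

lemma smul (c : ℂ) {T : HilbertPow Γ k →L[ℂ] HilbertPow Γ l}
    (hT : IsEquivariant T) : IsEquivariant (c • T) := fun g v => by
  simp [hT g, rightShift_smul]

lemma pow {T : HilbertPow Γ k →L[ℂ] HilbertPow Γ k} (hT : IsEquivariant T) (n : ℕ) :
    IsEquivariant (T ^ n) := by
  induction n with
  | zero => exact one
  | succ n ih => rw [pow_succ]; exact ih.comp hT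

lemma adjoint {T : HilbertPow Γ k →L[ℂ] HilbertPow Γ l} (hT : IsEquivariant T) :
    IsEquivariant (ContinuousLinearMap.adjoint T) := fun g v => by
  refine ext_inner_right ℂ fun w => ?_
  rw [ContinuousLinearMap.adjoint_inner_left, inner_rightShift_left, inner_rightShift_left, ← hT,
    ContinuousLinearMap.adjoint_inner_left]

lemma starProjection {K : Submodule ℂ (HilbertPow Γ k)} [K.HasOrthogonalProjection]
    (hK : ∀ (g : Γ), ∀ v ∈ K, rightShift g v ∈ K) : IsEquivariant K.starProjection := fun g v => by
  refine Submodule.eq_starProjection_of_mem_of_inner_eq_zero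
    (hK g _ (Submodule.starProjection_apply_mem K v)) fun w hw => ?_
  rw [← rightShift_sub, inner_rightShift_left]
  exact Submodule.starProjection_inner_eq_zero v _ (hK _ _ hw)

/-- The trace property. Both sides are the sum of the products
`⟨Y e_i, e_j g⟩ ⟨X (e_j g), e_i⟩` over `i`, `j` and `g ∈ Γ`. -/
theorem trace_comp_comm {X : HilbertPow Γ k →L[ℂ] HilbertPow Γ l}
    {Y : HilbertPow Γ l →L[ℂ] HilbertPow Γ k} (hX : IsEquivariant X) (hY : IsEquivariant Y) :
    trace (X ∘L Y) = trace (Y ∘L X) := by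
  have expand : ∀ {a b : ℕ} (X : HilbertPow Γ a →L[ℂ] HilbertPow Γ b)
      (Y : HilbertPow Γ b →L[ℂ] HilbertPow Γ a), trace (X ∘L Y) =
        ∑ j, ∑ i, ∑' g, inner ℂ (basisVec j 1) (X (basisVec i g)) *
          inner ℂ (basisVec i g) (Y (basisVec j 1)) := by
    intro a b X Y
    refine Finset.sum_congr rfl fun j _ => ?_
    rw [ContinuousLinearMap.comp_apply, ← ContinuousLinearMap.adjoint_inner_left,
      inner_eq_sum_tsum]
    simp only [ContinuousLinearMap.adjoint_inner_left]
  rw [expand, expand, Finset.sum_comm]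
  refine Finset.sum_congr rfl fun i _ => Finset.sum_congr rfl fun j _ => ?_
  rw [← (Equiv.inv Γ).tsum_eq]
  refine tsum_congr fun g => ?_
  have h1 : basisVec i (g⁻¹ : Γ) = rightShift g⁻¹ (basisVec i 1) := by simp [rightShift_basisVec]
  have h2 : basisVec j g = rightShift g (basisVec j 1) := by simp [rightShift_basisVec]
  rw [Equiv.inv_apply, h1, h2, hX, hY, inner_rightShift_left, inner_rightShift_left, inv_inv,
    mul_comm, ← inner_rightShift_left]

end IsEquivariant

end HilbertPow

/-! ### The rank–nullity theorem for the von Neumann dimension -/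

section

open Filter Topology

namespace HilbertPow

section Contraction

variable {E F : Type*} [NormedAddCommGroup E] [InnerProductSpace ℂ E] [CompleteSpace E]
  [NormedAddCommGroup F] [InnerProductSpace ℂ F] [CompleteSpace F]

open ContinuousLinearMap (adjoint)

lemma norm_one_sub_smul_adjoint_comp_le (T : E →L[ℂ] F) {c : ℝ} (hc : 0 ≤ c)
    (hcT : c * ‖T‖ ^ 2 ≤ 1) : ‖(1 : E →L[ℂ] E) - (c : ℂ) • (adjoint T ∘L T)‖ ≤ 1 := by
  refine ContinuousLinearMap.opNorm_le_bound _ zero_le_one fun x => ?_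
  rw [one_mul]
  refine le_of_sq_le_sq ?_ (norm_nonneg _)
  have h1 : ‖((1 : E →L[ℂ] E) - (c : ℂ) • (adjoint T ∘L T)) x‖ ^ 2 =
      ‖x‖ ^ 2 - 2 * (c * ‖T x‖ ^ 2) + c ^ 2 * ‖adjoint T (T x)‖ ^ 2 := by
    have h := norm_sub_sq (𝕜 := ℂ) x ((c : ℂ) • adjoint T (T x))
    rw [inner_smul_right, ContinuousLinearMap.adjoint_inner_right, inner_self_eq_norm_sq_to_K,
      norm_smul] at h
    have h2 : RCLike.re ((c : ℂ) * ((‖T x‖ : ℂ)) ^ 2) = c * ‖T x‖ ^ 2 := by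
      rw [← Complex.ofReal_pow, ← Complex.ofReal_mul]
      exact Complex.ofReal_re _
    refine h.trans ?_
    erw [h2]
    simp only [Complex.norm_real, Real.norm_eq_abs, mul_pow, sq_abs]
  rw [h1]
  have h3 : ‖adjoint T (T x)‖ ≤ ‖T‖ * ‖T x‖ := by
    refine (ContinuousLinearMap.le_opNorm _ _).trans_eq ?_
    rw [LinearIsometryEquiv.norm_map]
  have h4 : ‖adjoint T (T x)‖ ^ 2 ≤ ‖T‖ ^ 2 * ‖T x‖ ^ 2 := by
    rw [← mul_pow]; gcongr
  have h5 : c ^ 2 * ‖adjoint T (T x)‖ ^ 2 ≤ c * ‖T x‖ ^ 2 := by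
    calc c ^ 2 * ‖adjoint T (T x)‖ ^ 2 ≤ c ^ 2 * (‖T‖ ^ 2 * ‖T x‖ ^ 2) := by gcongr
      _ = (c * ‖T‖ ^ 2) * (c * ‖T x‖ ^ 2) := by ring
      _ ≤ 1 * (c * ‖T x‖ ^ 2) := by gcongr
      _ = _ := one_mul _
  have h6 : 0 ≤ c * ‖T x‖ ^ 2 := by positivity
  linarith

/-- The mean ergodic theorem for the contraction `1 - c T* T`, whose fixed points are the kernel of
`T`. -/
lemma tendsto_birkhoffAverage_ker (T : E →L[ℂ] F) {c : ℝ} (hc : 0 < c)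
    (hcT : c * ‖T‖ ^ 2 ≤ 1) (x : E) :
    Tendsto (fun n : ℕ => (n : ℂ)⁻¹ • ∑ k ∈ Finset.range n,
      (((1 : E →L[ℂ] E) - (c : ℂ) • (adjoint T ∘L T)) ^ k) x) atTop
      (𝓝 ((LinearMap.ker T.toLinearMap).starProjection x)) := by
  set f : E →L[ℂ] E := 1 - (c : ℂ) • (adjoint T ∘L T) with hf
  have hK : LinearMap.ker T.toLinearMap = f.eqLocus (1 : E →L[ℂ] E) := by
    ext v
    have h1 : v ∈ f.eqLocus (1 : E →L[ℂ] E) ↔ adjoint T (T v) = 0 := by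
      change f v = v ↔ _
      simp [hf, hc.ne']
    rw [h1, LinearMap.mem_ker]
    refine ⟨fun h => ?_, fun h => ?_⟩
    · change T v = 0 at h
      rw [h, map_zero]
    · change T v = 0
      rw [← inner_self_eq_zero (𝕜 := ℂ), ← ContinuousLinearMap.adjoint_inner_right, h,
        inner_zero_right]
  have key : ∀ (K : Submodule ℂ E) [K.HasOrthogonalProjection], K = f.eqLocus (1 : E →L[ℂ] E) →
      Tendsto (fun n : ℕ => (n : ℂ)⁻¹ • ∑ k ∈ Finset.range n, (f ^ k) x) atTop
        (𝓝 (K.starProjection x)) := by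
    intro K _ hK
    subst hK
    have h := f.tendsto_birkhoffAverage_orthogonalProjection
      (norm_one_sub_smul_adjoint_comp_le T hc.le hcT) x
    refine h.congr fun n => ?_
    simp [birkhoffAverage, birkhoffSum]
  exact key _ hK

end Contraction

variable {Γ : Type} [Group Γ] {k l : ℕ}

lemma trace_one : trace (1 : HilbertPow Γ k →L[ℂ] HilbertPow Γ k) = k := by
  have h : ∀ i : Fin k, (basisVec i (1 : Γ) : HilbertPow Γ k) i 1 = 1 := fun i => by
    classical
    rw [basisVec, PiLp.single_eq_same, ell2.delta, lp.single_apply, Pi.single_eq_same]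
  simp only [trace, inner_basisVec_left, one_apply_eq_self, h]
  simp

lemma trace_sub (S T : HilbertPow Γ k →L[ℂ] HilbertPow Γ k) :
    trace (S - T) = trace S - trace T := by
  simp [trace]

lemma trace_smul (c : ℂ) (T : HilbertPow Γ k →L[ℂ] HilbertPow Γ k) :
    trace (c • T) = c * trace T := by
  simp [trace, Finset.mul_sum]

open ContinuousLinearMap (adjoint)

/-- `T` intertwines the two contractions, and the trace property removes it from each step of an
induction on the exponent. -/
lemma trace_pow_sub (T : HilbertPow Γ k →L[ℂ] HilbertPow Γ l) (hT : IsEquivariant T) (c : ℂ)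
    (n : ℕ) :
    trace (((1 : HilbertPow Γ k →L[ℂ] HilbertPow Γ k) - c • (adjoint T ∘L T)) ^ n) - k =
      trace (((1 : HilbertPow Γ l →L[ℂ] HilbertPow Γ l) - c • (T ∘L adjoint T)) ^ n) - l := by
  set f : HilbertPow Γ k →L[ℂ] HilbertPow Γ k := 1 - c • (adjoint T ∘L T) with hf
  set f' : HilbertPow Γ l →L[ℂ] HilbertPow Γ l := 1 - c • (T ∘L adjoint T) with hf'
  have heq : IsEquivariant f := .sub .one (.smul c (hT.adjoint.comp hT))
  have hcomm : ∀ n, (T ∘L (f ^ n)) = ((f' ^ n) ∘L T) := by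
    intro n
    have h1 : ∀ x, T (f x) = f' (T x) := fun x => by simp [hf, hf']
    induction n with
    | zero => rfl
    | succ n ih =>
      ext1 x
      have := congrArg (fun S => S (f x)) ih
      simp only [ContinuousLinearMap.comp_apply] at this
      rw [ContinuousLinearMap.comp_apply, ContinuousLinearMap.comp_apply, pow_succ, pow_succ,
        mul_apply_eq_comp, mul_apply_eq_comp, this, h1]
  induction n with
  | zero => simp [trace_one]
  | succ n ih =>
    have h1 : f ^ (n + 1) = f ^ n - c • (((f ^ n) ∘L adjoint T) ∘L T) := by
      rw [pow_succ]
      ext1 x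
      have hx : f x = x - c • adjoint T (T x) := by simp [hf]
      change (f ^ n) (f x) = (f ^ n) x - c • (f ^ n) (adjoint T (T x))
      rw [hx, map_sub, map_smul]
    have h2 : f' ^ (n + 1) = f' ^ n - c • (((f' ^ n) ∘L T) ∘L adjoint T) := by
      rw [pow_succ]
      ext1 x
      have hx : f' x = x - c • T (adjoint T x) := by simp [hf']
      change (f' ^ n) (f' x) = (f' ^ n) x - c • (f' ^ n) (T (adjoint T x))
      rw [hx, map_sub, map_smul]
    have h3 : trace (((f ^ n) ∘L adjoint T) ∘L T) = trace (((f' ^ n) ∘L T) ∘L adjoint T) := by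
      rw [← hcomm, ContinuousLinearMap.comp_assoc T]
      exact (IsEquivariant.trace_comp_comm hT ((heq.pow n).comp hT.adjoint)).symm
    rw [h1, h2, trace_sub, trace_sub, trace_smul, trace_smul, h3]
    linear_combination ih

/-- The rank–nullity theorem for the von Neumann dimension. The traces of the powers of the
contractions `1 - c T* T` and `1 - c T T*` differ by a constant, and their averages converge to the
projections onto the kernels of `T` and `T*`. -/
theorem trace_ker_add_trace_range (T : HilbertPow Γ k →L[ℂ] HilbertPow Γ l)
    (hT : IsEquivariant T)
    [(LinearMap.range T.toLinearMap).topologicalClosure.HasOrthogonalProjection] :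
    trace (LinearMap.ker T.toLinearMap).starProjection +
      trace (LinearMap.range T.toLinearMap).topologicalClosure.starProjection = k := by
  set c : ℝ := (‖T‖ ^ 2 + 1)⁻¹ with hc
  have hc0 : 0 < c := by positivity
  have hcT : c * ‖T‖ ^ 2 ≤ 1 := by
    rw [hc, inv_mul_le_iff₀ (by positivity)]
    linarith
  have hcT' : c * ‖adjoint T‖ ^ 2 ≤ 1 := by rwa [LinearIsometryEquiv.norm_map]
  have lim : ∀ {a b : ℕ} (T : HilbertPow Γ a →L[ℂ] HilbertPow Γ b), c * ‖T‖ ^ 2 ≤ 1 →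
      Tendsto (fun n : ℕ => (n : ℂ)⁻¹ * ∑ m ∈ Finset.range n,
        trace (((1 : HilbertPow Γ a →L[ℂ] HilbertPow Γ a) - (c : ℂ) • (adjoint T ∘L T)) ^ m)) atTop
        (𝓝 (trace (LinearMap.ker T.toLinearMap).starProjection)) := by
    intro a b T hcT
    have h := tendsto_finsetSum (Finset.univ : Finset (Fin a)) fun i _ =>
      Tendsto.inner (𝕜 := ℂ) (tendsto_const_nhds (x := basisVec i (1 : Γ)))
        (tendsto_birkhoffAverage_ker T hc0 hcT (basisVec i (1 : Γ)))
    refine h.congr fun n => ?_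
    simp only [inner_smul_right, inner_sum, trace, ← Finset.mul_sum]
    rw [Finset.sum_comm]
  have h1 := lim T hcT
  have h2 := lim (adjoint T) hcT'
  rw [ContinuousLinearMap.adjoint_adjoint] at h2
  have h3 : trace (LinearMap.ker T.toLinearMap).starProjection - k =
      trace (LinearMap.ker (adjoint T).toLinearMap).starProjection - l := by
    refine tendsto_nhds_unique (h1.sub_const (k : ℂ)) ((h2.sub_const (l : ℂ)).congr' ?_)
    filter_upwards [eventually_gt_atTop 0] with n hn
    have hn' : (n : ℂ) ≠ 0 := by exact_mod_cast hn.ne'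
    have h4 := Finset.sum_congr rfl fun m (_ : m ∈ Finset.range n) => trace_pow_sub T hT (c : ℂ) m
    rw [Finset.sum_sub_distrib, Finset.sum_sub_distrib] at h4
    simp only [Finset.sum_const, Finset.card_range, nsmul_eq_mul] at h4
    field_simp
    linear_combination -h4
  have h5 : LinearMap.ker (adjoint T).toLinearMap =
      (LinearMap.range T.toLinearMap).topologicalClosureᗮ := by
    rw [Submodule.orthogonal_closure]
    exact (ContinuousLinearMap.orthogonal_range T).symm
  have h6 : ∀ (K K' : Submodule ℂ (HilbertPow Γ l)) [K.HasOrthogonalProjection]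
      [K'.HasOrthogonalProjection], K' = Kᗮ →
      trace K'.starProjection = l - trace K.starProjection := by
    intro K K' _ _ h
    subst h
    rw [Submodule.starProjection_orthogonal', trace_sub, trace_one]
  rw [h6 _ _ h5] at h3
  linear_combination h3

end HilbertPow

end

/-! ### Matrices over the group von Neumann algebra as operators -/

namespace GroupVN

variable {Γ : Type} [Group Γ]

lemma toOperator_injective : Function.Injective (toOperator : GroupVN Γ → _) :=
  Subtype.val_injective

lemma toOperator_mul (a b : GroupVN Γ) : (a * b).toOperator = a.toOperator ∘L b.toOperator := rfl

lemma toOperator_sum {ι : Type} (s : Finset ι) (f : ι → GroupVN Γ) :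
    (∑ i ∈ s, f i).toOperator = ∑ i ∈ s, (f i).toOperator :=
  map_sum (vnSubalgebra Γ).val f s

lemma toOperator_perm (a : GroupVN Γ) (g : Γ) (v : ell2 Γ) :
    a.toOperator (ell2.perm (Equiv.mulRight g) v) = ell2.perm (Equiv.mulRight g) (a.toOperator v) :=
  (DFunLike.congr_fun ((Subalgebra.mem_centralizer_iff ℂ).1 a.2 _ ⟨g, rfl⟩) v).symm

/-- The element of the group von Neumann algebra given by an operator that commutes with right
translations. -/
def mk (T : ell2 Γ →L[ℂ] ell2 Γ) (hT : ∀ (g : Γ) v,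
    T (ell2.perm (Equiv.mulRight g) v) = ell2.perm (Equiv.mulRight g) (T v)) : GroupVN Γ :=
  (⟨T, by
    rw [vnSubalgebra, Subalgebra.mem_centralizer_iff]
    rintro _ ⟨g, rfl⟩
    ext1 v
    exact (hT g v).symm⟩ : vnSubalgebra Γ)

lemma of_mul (g h : Γ) : of (g * h) = of g * of h := by
  apply toOperator_injective
  ext f x
  change f ((Equiv.mulLeft (g * h))⁻¹ x) = f ((Equiv.mulLeft h)⁻¹ ((Equiv.mulLeft g)⁻¹ x))
  simp [mul_assoc]

lemma of_one : of (1 : Γ) = 1 := by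
  apply toOperator_injective
  ext f x
  change f ((Equiv.mulLeft (1 : Γ))⁻¹ x) = f x
  simp

/-- The left translations, as a homomorphism to the multiplicative monoid of the group von Neumann
algebra. -/
def ofHom (Γ : Type) [Group Γ] : Γ →* GroupVN Γ where
  toFun := of
  map_one' := of_one
  map_mul' := of_mul

/-- The embedding of the group algebra into the group von Neumann algebra. -/
def ofGroupAlgebra (Γ : Type) [Group Γ] : MonoidAlgebra ℂ Γ →+* GroupVN Γ :=
  (MonoidAlgebra.lift ℂ (vnSubalgebra Γ) Γ (ofHom Γ)).toRingHom

lemma ofGroupAlgebra_of (g : Γ) : ofGroupAlgebra Γ (MonoidAlgebra.of ℂ Γ g) = of g := by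
  exact MonoidAlgebra.lift_of (R := ℂ) (A := vnSubalgebra Γ) (ofHom Γ) g

lemma toOperator_ofGroupAlgebra (a : MonoidAlgebra ℂ Γ) (v : ell2 Γ) :
    (ofGroupAlgebra Γ a).toOperator v = (leftRegular Γ).asAlgebraHom a v := by
  induction a using MonoidAlgebra.induction_linear with
  | zero => rw [map_zero, map_zero]; rfl
  | add a b ha hb => rw [map_add, map_add, LinearMap.add_apply, ← ha, ← hb]; rfl
  | single g c =>
    rw [Representation.asAlgebraHom_single]
    have h : ofGroupAlgebra Γ (MonoidAlgebra.single g c) =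
        (c • (show vnSubalgebra Γ from of g) : vnSubalgebra Γ) :=
      MonoidAlgebra.lift_single (R := ℂ) (A := vnSubalgebra Γ) (ofHom Γ) g c
    rw [h]
    rfl

end GroupVN

namespace HilbertPow

variable {Γ : Type} [Group Γ] {r s t : ℕ}

/-- The operator on column vectors over `ℓ²(Γ)` given by a matrix over the group von Neumann
algebra. -/
def ofMatrix (E : Matrix (Fin r) (Fin s) (GroupVN Γ)) : HilbertPow Γ s →L[ℂ] HilbertPow Γ r :=
  (PiLp.continuousLinearEquiv 2 ℂ fun _ : Fin r => ell2 Γ).symm.toContinuousLinearMap ∘L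
    ContinuousLinearMap.pi fun i => ∑ j, (E i j).toOperator ∘L PiLp.proj 2 (fun _ => ell2 Γ) j

lemma ofMatrix_apply (E : Matrix (Fin r) (Fin s) (GroupVN Γ)) (v : HilbertPow Γ s) (i : Fin r) :
    ofMatrix E v i = ∑ j, (E i j).toOperator (v j) := by
  simp [ofMatrix]

lemma ofMatrix_mul (E : Matrix (Fin r) (Fin s) (GroupVN Γ))
    (F : Matrix (Fin s) (Fin t) (GroupVN Γ)) (v : HilbertPow Γ t) :
    ofMatrix (E * F) v = ofMatrix E (ofMatrix F v) := by
  ext1 i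
  simp only [ofMatrix_apply, Matrix.mul_apply, GroupVN.toOperator_sum, GroupVN.toOperator_mul,
    map_sum, sum_apply, ContinuousLinearMap.comp_apply]
  exact Finset.sum_comm

lemma ofMatrix_injective :
    Function.Injective (ofMatrix : Matrix (Fin r) (Fin s) (GroupVN Γ) → _) := by
  intro E F h
  ext i j
  apply GroupVN.toOperator_injective
  ext1 v
  have h1 := congrArg (fun T => T (PiLp.single 2 (β := fun _ : Fin s => ell2 Γ) j v) i) h
  simp only [ofMatrix_apply] at h1
  rw [Finset.sum_eq_single j, Finset.sum_eq_single j] at h1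
  · simpa using h1
  all_goals simp +contextual [PiLp.single_eq_of_ne]

lemma ofMatrix_isEquivariant (E : Matrix (Fin r) (Fin s) (GroupVN Γ)) :
    IsEquivariant (ofMatrix E) := fun g v => by
  ext1 i
  simp [ofMatrix_apply, rightShift_apply, GroupVN.toOperator_perm]

lemma trace_ofMatrix (E : Matrix (Fin r) (Fin r) (GroupVN Γ)) :
    trace (ofMatrix E) = ∑ i, vnTrace (E i i) := by
  refine Finset.sum_congr rfl fun i _ => ?_
  rw [inner_basisVec_left, vnTrace, ell2.inner_delta_left, ofMatrix_apply,
    Finset.sum_eq_single i]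
  · rw [basisVec, PiLp.single_eq_same]
  · intro b _ hb
    rw [basisVec, PiLp.single_eq_of_ne _ hb, map_zero]
  · simp

/-- Every operator that commutes with right translations is given by a matrix over the group von
Neumann algebra. -/
lemma exists_ofMatrix {T : HilbertPow Γ s →L[ℂ] HilbertPow Γ r} (hT : IsEquivariant T) :
    ∃ E : Matrix (Fin r) (Fin s) (GroupVN Γ), ofMatrix E = T := by
  let incl : Fin s → ell2 Γ →L[ℂ] HilbertPow Γ s := fun j =>
    (PiLp.continuousLinearEquiv 2 ℂ fun _ : Fin s => ell2 Γ).symm.toContinuousLinearMap ∘L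
      ContinuousLinearMap.single ℂ (fun _ : Fin s => ell2 Γ) j
  have hincl : ∀ j v, incl j v = PiLp.single 2 (β := fun _ : Fin s => ell2 Γ) j v :=
    fun j v => rfl
  have hshift : ∀ j (g : Γ) v, incl j (ell2.perm (Equiv.mulRight g) v) =
      rightShift g (incl j v) := by
    intro j g v
    ext1 a
    rw [rightShift_apply, hincl, hincl]
    by_cases ha : a = j
    · subst ha; simp
    · rw [PiLp.single_eq_of_ne _ ha, PiLp.single_eq_of_ne _ ha, map_zero]
  have hcomm : ∀ i j (g : Γ) v, (PiLp.proj 2 (fun _ => ell2 Γ) i ∘L T ∘L incl j)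
      (ell2.perm (Equiv.mulRight g) v) = ell2.perm (Equiv.mulRight g)
        ((PiLp.proj 2 (fun _ => ell2 Γ) i ∘L T ∘L incl j) v) := by
    intro i j g v
    simp only [ContinuousLinearMap.comp_apply]
    rw [hshift, hT g]
    rfl
  refine ⟨Matrix.of fun i j => GroupVN.mk _ (hcomm i j), ?_⟩
  ext1 v
  ext1 i
  rw [ofMatrix_apply]
  change ∑ j, T (incl j (v j)) i = _
  have h1 : ∑ j, incl j (v j) = v := by
    ext1 a
    rw [WithLp.ofLp_sum, Finset.sum_apply, Finset.sum_eq_single a]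
    · simp [hincl]
    · intro b _ hb
      rw [hincl, PiLp.single_eq_of_ne' _ hb]
    · simp
  conv_rhs => rw [← h1]
  rw [map_sum, WithLp.ofLp_sum, Finset.sum_apply]

/-- The operator on column vectors over `ℓ²(Γ)` given by a matrix over the group algebra. -/
def ofGroupMatrix (A : Matrix (Fin r) (Fin s) (MonoidAlgebra ℂ Γ)) :
    HilbertPow Γ s →L[ℂ] HilbertPow Γ r :=
  ofMatrix (A.map (GroupVN.ofGroupAlgebra Γ))

lemma ofGroupMatrix_apply (A : Matrix (Fin r) (Fin s) (MonoidAlgebra ℂ Γ)) (v : HilbertPow Γ s) :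
    ofGroupMatrix A v = WithLp.toLp 2 (matrixAction (leftRegular Γ) A v.ofLp) := by
  ext1 i
  rw [ofGroupMatrix, ofMatrix_apply]
  refine Eq.trans ?_ (matrixAction_apply (leftRegular Γ) A v.ofLp i).symm
  simp only [Matrix.map_apply, GroupVN.toOperator_ofGroupAlgebra]

end HilbertPow

lemma ell2.closure_span_delta (Γ : Type) :
    (Submodule.span ℂ (Set.range (ell2.delta : Γ → ell2 Γ))).topologicalClosure = ⊤ := by
  classical
  refine eq_top_iff.2 fun f _ => ?_
  have h := lp.hasSum_single (p := 2) (by norm_num) f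
  refine mem_closure_of_tendsto h (Filter.Eventually.of_forall fun s => ?_)
  refine Submodule.sum_mem _ fun g _ => ?_
  have h1 : lp.single 2 g (f g) = f g • ell2.delta g := by
    rw [ell2.delta, ← lp.single_smul, smul_eq_mul, mul_one]
  rw [h1]
  exact Submodule.smul_mem _ _ (Submodule.subset_span ⟨g, rfl⟩)

lemma twistedVector_bot {Γ : Type} [Group Γ] (Z : Subgroup Γ) (hZ : Z = ⊥) (χ : Z →* ℂˣ) :
    twistedVector Z χ = ell2.delta 1 := by
  subst hZ
  rw [twistedVector, finsum_eq_single _ (1 : (⊥ : Subgroup Γ))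
    fun x hx => absurd (Subsingleton.elim x 1) hx]
  simp

/-- For a trivial central subgroup the twisted rank is the von Neumann dimension of the closure of
the image. -/
lemma twistedRank_bot {Γ : Type} [Group Γ] (Z : Subgroup Γ) (hZ : Z = ⊥) (χ : Z →* ℂˣ) {r s : ℕ}
    (A : Matrix (Fin r) (Fin s) (MonoidAlgebra ℂ Γ))
    [(LinearMap.range
      (HilbertPow.ofGroupMatrix A).toLinearMap).topologicalClosure.HasOrthogonalProjection] :
    twistedRank Z χ A = (HilbertPow.trace (LinearMap.range
      (HilbertPow.ofGroupMatrix A).toLinearMap).topologicalClosure.starProjection).re := by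
  have hdelta : ∀ g : Γ, leftRegular Γ g (ell2.delta 1) = ell2.delta g := fun g => by
    refine (ell2.perm_delta (Equiv.mulLeft g) 1).trans ?_
    simp
  have htop : twistedEll2 Z χ = ⊤ := by
    rw [twistedEll2, twistedVector_bot Z hZ, ← ell2.closure_span_delta Γ]
    simp only [hdelta]
  have himg : twistedImage Z χ A =
      (LinearMap.range (HilbertPow.ofGroupMatrix A).toLinearMap).topologicalClosure := by
    rw [twistedImage, htop]
    congr 1
    ext x
    simp only [Submodule.mem_map, LinearMap.mem_range]
    constructor
    · rintro ⟨v, -, rfl⟩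
      exact ⟨WithLp.toLp 2 v, HilbertPow.ofGroupMatrix_apply A _⟩
    · rintro ⟨v, rfl⟩
      exact ⟨v.ofLp, by simp, (HilbertPow.ofGroupMatrix_apply A v).symm⟩
  have key : ∀ (K K' : Submodule ℂ (HilbertPow Γ r)) [K.HasOrthogonalProjection]
      [K'.HasOrthogonalProjection], K = K' →
      ∑ i : Fin r, (inner ℂ (PiLp.single 2 (β := fun _ : Fin r => ell2 Γ) i (twistedVector Z χ))
        (K.starProjection (PiLp.single 2 (β := fun _ : Fin r => ell2 Γ) i
          (twistedVector Z χ)))).re = (HilbertPow.trace K'.starProjection).re := by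
    intro K K' _ _ h
    subst h
    rw [twistedVector_bot Z hZ, HilbertPow.trace, Complex.re_sum]
    rfl
  have : CompleteSpace (twistedImage Z χ A) := Submodule.topologicalClosure.completeSpace _
  exact key _ _ himg

/-! ### Base change of maps between free modules -/

section BaseChange

variable {R S : Type} [Ring R] [Ring S] (φ : R →+* S) {X Y Z : Type}

/-- The extension of scalars along `φ` of a homomorphism between free modules with given bases. -/
def baseChange (F : (X →₀ R) →ₗ[R] (Y →₀ R)) : (X →₀ S) →ₗ[S] (Y →₀ S) :=
  Finsupp.linearCombination S fun x => (F (Finsupp.single x 1)).mapRange φ φ.map_zero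

lemma baseChange_single (F : (X →₀ R) →ₗ[R] (Y →₀ R)) (x : X) :
    baseChange φ F (Finsupp.single x 1) = (F (Finsupp.single x 1)).mapRange φ φ.map_zero := by
  simp [baseChange]

lemma mapRange_smul (r : R) (y : Y →₀ R) :
    (r • y).mapRange φ φ.map_zero = φ r • y.mapRange φ φ.map_zero := by
  ext; simp

lemma baseChange_mapRange (F : (X →₀ R) →ₗ[R] (Y →₀ R)) (x : X →₀ R) :
    baseChange φ F (x.mapRange φ φ.map_zero) = (F x).mapRange φ φ.map_zero := by
  induction x using Finsupp.induction_linear with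
  | zero => simp
  | add a b ha hb =>
    rw [Finsupp.mapRange_add (map_add φ), map_add, map_add, ha, hb,
      Finsupp.mapRange_add (map_add φ)]
  | single x r =>
    rw [Finsupp.mapRange_single, ← mul_one (φ r), ← smul_eq_mul, ← Finsupp.smul_single, map_smul,
      baseChange_single, ← mapRange_smul, ← map_smul, Finsupp.smul_single, smul_eq_mul, mul_one]

lemma baseChange_comp (F : (Y →₀ R) →ₗ[R] (Z →₀ R)) (G : (X →₀ R) →ₗ[R] (Y →₀ R)) (x : X →₀ S) :
    baseChange φ F (baseChange φ G x) = baseChange φ (F ∘ₗ G) x := by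
  suffices baseChange φ F ∘ₗ baseChange φ G = baseChange φ (F ∘ₗ G) from LinearMap.congr_fun this x
  apply Finsupp.lhom_ext'
  intro x
  apply LinearMap.ext_ring
  simp only [LinearMap.comp_apply, Finsupp.lsingle_apply, baseChange_single, baseChange_mapRange]

lemma baseChange_add (F G : (X →₀ R) →ₗ[R] (Y →₀ R)) (x : X →₀ S) :
    baseChange φ (F + G) x = baseChange φ F x + baseChange φ G x := by
  suffices baseChange φ (F + G) = baseChange φ F + baseChange φ G from LinearMap.congr_fun this x
  apply Finsupp.lhom_ext'
  intro x
  apply LinearMap.ext_ring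
  simp only [LinearMap.comp_apply, Finsupp.lsingle_apply, baseChange_single, LinearMap.add_apply]
  exact Finsupp.mapRange_add (map_add φ) _ _

lemma baseChange_id (x : X →₀ S) : baseChange φ (LinearMap.id : (X →₀ R) →ₗ[R] _) x = x := by
  suffices baseChange φ (LinearMap.id : (X →₀ R) →ₗ[R] _) = LinearMap.id from
    LinearMap.congr_fun this x
  apply Finsupp.lhom_ext'
  intro x
  apply LinearMap.ext_ring
  simp [baseChange_single]

/-- The map between free modules that multiplies row vectors by a matrix. -/
def rowMap {k l : ℕ} (A : Matrix (Fin k) (Fin l) R) : (Fin k →₀ R) →ₗ[R] (Fin l →₀ R) :=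
  (Finsupp.linearEquivFunOnFinite R R (Fin l)).symm.toLinearMap ∘ₗ A.vecMulLinear ∘ₗ
    (Finsupp.linearEquivFunOnFinite R R (Fin k)).toLinearMap

lemma rowMap_single {k l : ℕ} (A : Matrix (Fin k) (Fin l) R) (a : Fin k) (b : Fin l) :
    rowMap A (Finsupp.single a 1) b = A a b := by
  classical
  change Matrix.vecMul (⇑(Finsupp.single a (1 : R))) A b = A a b
  rw [Finsupp.single_eq_pi_single, Matrix.single_one_vecMul, Matrix.row_apply]

lemma baseChange_rowMap {k l : ℕ} (A : Matrix (Fin k) (Fin l) R) :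
    baseChange φ (rowMap A) = rowMap (A.map φ) := by
  apply Finsupp.lhom_ext'
  intro x
  apply LinearMap.ext_ring
  ext b
  simp only [LinearMap.comp_apply, Finsupp.lsingle_apply, baseChange_single, rowMap_single,
    Finsupp.mapRange_apply, Matrix.map_apply]

end BaseChange

lemma baseChange_barDifferential (Γ : Type) [Group Γ] (m : ℕ) :
    baseChange (GroupVN.ofGroupAlgebra Γ) (barDifferential _ (MonoidAlgebra.of ℂ Γ) m) =
      barDiff Γ m := by
  apply Finsupp.lhom_ext'
  intro g
  apply LinearMap.ext_ring
  simp only [LinearMap.comp_apply, Finsupp.lsingle_apply, baseChange_single,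
    barDifferential_single, barDiff, Finsupp.linearCombination_single, one_smul]
  rw [Finsupp.mapRange_add (map_add _), Finsupp.mapRange_single, GroupVN.ofGroupAlgebra_of]
  congr 1
  refine (map_sum (Finsupp.mapRange.addMonoidHom
    (GroupVN.ofGroupAlgebra Γ).toAddMonoidHom) _ _).trans ?_
  refine Finset.sum_congr rfl fun j _ => ?_
  rw [map_zsmul]
  simp

/-- Up to maps that vanish on cycles, the free module on the generators of a presentation of the
cokernel is a retract of the bar resolution: the composite `v ∘ u` is the identity modulo the
coboundaries `rowMap D.mat` and the relations `rowMap D.rel`. -/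
lemma exists_retraction_bar {Γ : Type} [Group Γ] (P : CategoryTheory.ProjectiveResolution
      (ModuleCat.of (MonoidAlgebra ℂ Γ) (Representation.trivial ℂ Γ ℂ).asModule)) (i : ℕ)
    (D : MatrixPresentation (cokernelDiff P.complex i)) :
    ∃ (u : (Fin D.k →₀ MonoidAlgebra ℂ Γ) →ₗ[MonoidAlgebra ℂ Γ]
        ((Fin i → Γ) →₀ MonoidAlgebra ℂ Γ))
      (u' : (Fin D.l →₀ MonoidAlgebra ℂ Γ) →ₗ[MonoidAlgebra ℂ Γ]
        ((Fin (i - 1) → Γ) →₀ MonoidAlgebra ℂ Γ))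
      (v : ((Fin i → Γ) →₀ MonoidAlgebra ℂ Γ) →ₗ[MonoidAlgebra ℂ Γ]
        (Fin D.k →₀ MonoidAlgebra ℂ Γ))
      (y : (Fin D.l →₀ MonoidAlgebra ℂ Γ) →ₗ[MonoidAlgebra ℂ Γ] (Fin D.k →₀ MonoidAlgebra ℂ Γ))
      (z : (Fin D.k →₀ MonoidAlgebra ℂ Γ) →ₗ[MonoidAlgebra ℂ Γ] (Fin D.m →₀ MonoidAlgebra ℂ Γ))
      (z' : ((Fin (i + 1) → Γ) →₀ MonoidAlgebra ℂ Γ) →ₗ[MonoidAlgebra ℂ Γ]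
        (Fin D.m →₀ MonoidAlgebra ℂ Γ)),
      barBoundary _ (MonoidAlgebra.of ℂ Γ) i ∘ₗ u = u' ∘ₗ rowMap D.mat ∧
      v ∘ₗ u = LinearMap.id + y ∘ₗ rowMap D.mat + rowMap D.rel ∘ₗ z ∧
      v ∘ₗ barDifferential _ (MonoidAlgebra.of ℂ Γ) i = rowMap D.rel ∘ₗ z' := by
  obtain ⟨f, g, hf, hg, hh, -⟩ := exists_comparison_bar Γ P
  obtain ⟨h, h', hh⟩ := hh i
  let q := (LinearMap.range (P.complex.d (i + 1) i).hom).mkQ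
  choose x hx using fun a => Submodule.mkQ_surjective _ (D.gen a)
  let π := Finsupp.linearCombination (MonoidAlgebra ℂ Γ) D.gen
  let πQ := Finsupp.linearCombination (MonoidAlgebra ℂ Γ) D.genQ
  have hq : ∀ y, q (P.complex.d (i + 1) i y) = 0 := fun y =>
    (Submodule.Quotient.mk_eq_zero _).2 ⟨y, rfl⟩
  have hπ : Function.Surjective π := by
    intro c
    obtain ⟨r, rfl⟩ := D.span_gen c
    refine ⟨Finsupp.equivFunOnFinite.symm r, ?_⟩
    simp [π, Finsupp.linearCombination_apply, Finsupp.sum_fintype]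
  have hker : ∀ {X : Type} (F : (X →₀ MonoidAlgebra ℂ Γ) →ₗ[MonoidAlgebra ℂ Γ]
      (Fin D.k →₀ MonoidAlgebra ℂ Γ)), (∀ x, π (F (Finsupp.single x 1)) = 0) →
      ∃ w : (X →₀ MonoidAlgebra ℂ Γ) →ₗ[MonoidAlgebra ℂ Γ] (Fin D.m →₀ MonoidAlgebra ℂ Γ),
        F = rowMap D.rel ∘ₗ w := by
    intro X F hF
    have h1 : ∀ x, ∃ w, rowMap D.rel w = F (Finsupp.single x 1) := by
      intro x
      obtain ⟨w, hw⟩ := (D.rel_iff (F (Finsupp.single x 1))).1 (by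
          rw [← hF x]
          simp [π, Finsupp.linearCombination_apply, Finsupp.sum_fintype])
      refine ⟨Finsupp.equivFunOnFinite.symm w, ?_⟩
      apply DFunLike.coe_injective
      exact hw
    choose w hw using h1
    refine ⟨Finsupp.linearCombination _ w, ?_⟩
    apply Finsupp.lhom_ext'
    intro x
    apply LinearMap.ext_ring
    simp [hw]
  have hmat : ∀ a, πQ (rowMap D.mat (Finsupp.single a 1)) = cokernelDiff P.complex i (D.gen a) := by
    intro a
    rw [← D.sum_mat]
    simp [πQ, Finsupp.linearCombination_apply, Finsupp.sum_fintype, rowMap_single]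
  have hd : ∀ y, cokernelDiff P.complex i (q y) = P.complex.d i (i - 1) y := fun y => rfl
  obtain ⟨v, hv⟩ := Module.projective_lifting_property π (q ∘ₗ g i) hπ
  obtain ⟨y, hy⟩ := Module.projective_lifting_property π (q ∘ₗ h' ∘ₗ πQ) hπ
  replace hv : ∀ b, π (v b) = q (g i b) := LinearMap.congr_fun hv
  replace hy : ∀ b, π (y b) = q (h' (πQ b)) := LinearMap.congr_fun hy
  let u := Finsupp.linearCombination (MonoidAlgebra ℂ Γ) fun a => f i (x a)
  obtain ⟨z, hz⟩ := hker (v ∘ₗ u - LinearMap.id - y ∘ₗ rowMap D.mat) (by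
    intro a
    simp only [LinearMap.sub_apply, LinearMap.comp_apply, LinearMap.id_apply, map_sub, hv, hy, hmat]
    have h1 : u (Finsupp.single a 1) = f i (x a) := by simp [u]
    have h2 : π (Finsupp.single a 1) = D.gen a := by simp [π]
    rw [h1, h2, ← hx, hh, map_add, map_add, hq]
    change 0 + q (h' (P.complex.d i (i - 1) (x a))) + q (x a) - q (x a) -
      q (h' (cokernelDiff P.complex i (q (x a)))) = 0
    rw [hd]
    abel)
  obtain ⟨z', hz'⟩ := hker (v ∘ₗ barDifferential _ (MonoidAlgebra.of ℂ Γ) i) (by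
    intro b
    rw [LinearMap.comp_apply, hv]
    exact (congrArg q (hg (i + 1) _).symm).trans (hq _))
  refine ⟨u, f (i - 1) ∘ₗ πQ, v, y, z, z', ?_, ?_, hz'⟩
  · apply Finsupp.lhom_ext'
    intro a
    apply LinearMap.ext_ring
    simp only [LinearMap.comp_apply, Finsupp.lsingle_apply]
    rw [hmat, ← hx]
    have h1 : u (Finsupp.single a 1) = f i (x a) := by simp [u]
    rw [h1, hf]
    rfl
  · rw [← hz]
    abel

/-! ### Harmonic cochains and the vanishing of `ℓ²`-Betti numbers -/

section

open HilbertPow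

section RowSpace

variable {R S : Type} [Ring R] [Ring S] (φ : R →+* S) {X X₁ X₂ : Type} {k l m : ℕ}

/-- A row vector as an element of the free module of finitely supported functions. -/
def rowVector (w : Fin k → S) : Fin k →₀ S := Finsupp.equivFunOnFinite.symm w

lemma rowMap_rowVector (A : Matrix (Fin k) (Fin l) S) (w : Fin k → S) :
    rowMap A (rowVector w) = rowVector (Matrix.vecMul w A) := rfl

lemma exists_rowVector (x : Fin k →₀ S) : ∃ w, x = rowVector w :=
  ⟨x, (Finsupp.equivFunOnFinite.symm_apply_apply x).symm⟩

lemma rowVector_injective : Function.Injective (rowVector : (Fin k → S) → _) :=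
  Finsupp.equivFunOnFinite.symm.injective

lemma rowVector_zero : rowVector (0 : Fin k → S) = 0 := by
  ext
  rfl

/-- Let a free module be a retract of a complex of free modules up to maps through the matrices
`mat` and `rel`. After extension of scalars, the rows of a matrix `E` with `E * mat = 0` become
cycles. -/
lemma baseChange_rowVector_eq_zero {mat : Matrix (Fin k) (Fin l) R}
    {δ : (X →₀ R) →ₗ[R] (X₁ →₀ R)} {u : (Fin k →₀ R) →ₗ[R] (X →₀ R)}
    {u' : (Fin l →₀ R) →ₗ[R] (X₁ →₀ R)} (h1 : δ ∘ₗ u = u' ∘ₗ rowMap mat)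
    {E : Matrix (Fin k) (Fin k) S} (hE : E * mat.map φ = 0) (w : Fin k → S) :
    baseChange φ δ (baseChange φ u (rowVector (Matrix.vecMul w E))) = 0 := by
  rw [baseChange_comp, h1, ← baseChange_comp, baseChange_rowMap, rowMap_rowVector,
    Matrix.vecMul_vecMul, hE, Matrix.vecMul_zero, rowVector_zero, map_zero]

/-- In the situation of `baseChange_rowVector_eq_zero`, the rows of an idempotent matrix `E` with
`rel * E = 0` are boundaries only if they are zero. -/
lemma vecMul_eq_zero_of_boundary {mat : Matrix (Fin k) (Fin l) R} {rel : Matrix (Fin m) (Fin k) R}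
    {δ' : (X₂ →₀ R) →ₗ[R] (X →₀ R)} {u : (Fin k →₀ R) →ₗ[R] (X →₀ R)}
    {v : (X →₀ R) →ₗ[R] (Fin k →₀ R)} {y : (Fin l →₀ R) →ₗ[R] (Fin k →₀ R)}
    {z : (Fin k →₀ R) →ₗ[R] (Fin m →₀ R)} {z' : (X₂ →₀ R) →ₗ[R] (Fin m →₀ R)}
    (h2 : v ∘ₗ u = LinearMap.id + y ∘ₗ rowMap mat + rowMap rel ∘ₗ z)
    (h3 : v ∘ₗ δ' = rowMap rel ∘ₗ z') {E : Matrix (Fin k) (Fin k) S} (hEE : E * E = E)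
    (hE : E * mat.map φ = 0) (hE' : rel.map φ * E = 0) (w : Fin k → S) (b : X₂ →₀ S)
    (hb : baseChange φ δ' b = baseChange φ u (rowVector (Matrix.vecMul w E))) :
    Matrix.vecMul w E = 0 := by
  set x := Matrix.vecMul w E with hx
  have h5 := congrArg (baseChange φ v) hb
  have h4 : baseChange φ (rowMap mat) (rowVector x) = 0 := by
    rw [baseChange_rowMap, rowMap_rowVector, hx, Matrix.vecMul_vecMul, hE, Matrix.vecMul_zero,
      rowVector_zero]
  rw [baseChange_comp, baseChange_comp, h3, h2, baseChange_add, baseChange_add, baseChange_id,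
    ← baseChange_comp φ y, h4, map_zero, add_zero, ← baseChange_comp, ← baseChange_comp,
    ← sub_eq_iff_eq_add, ← map_sub, baseChange_rowMap] at h5
  obtain ⟨t, ht⟩ := exists_rowVector (baseChange φ z' b - baseChange φ z (rowVector x))
  rw [ht, rowMap_rowVector, rowVector_injective.eq_iff] at h5
  have h6 : x = Matrix.vecMul x E := by rw [hx, Matrix.vecMul_vecMul, hEE]
  rw [h6, ← h5, Matrix.vecMul_vecMul, hE', Matrix.vecMul_zero]

end RowSpace

/-- The row space of an idempotent matrix that consists of cocycles and is orthogonal to the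
coboundaries embeds into the homology of the bar complex. -/
lemma exists_injective_l2Homology {Γ : Type} [Group Γ] (P : CategoryTheory.ProjectiveResolution
      (ModuleCat.of (MonoidAlgebra ℂ Γ) (Representation.trivial ℂ Γ ℂ).asModule)) (i : ℕ)
    (D : MatrixPresentation (cokernelDiff P.complex i))
    (E : Matrix (Fin D.k) (Fin D.k) (GroupVN Γ)) (hE : E * E = E)
    (hEA : E * D.mat.map (GroupVN.ofGroupAlgebra Γ) = 0)
    (hTE : D.rel.map (GroupVN.ofGroupAlgebra Γ) * E = 0) :
    ∃ f : LinearMap.range E.vecMulLinear →ₗ[GroupVN Γ] l2Homology Γ i, Function.Injective f := by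
  obtain ⟨u, u', v, y, z, z', h1, h2, h3⟩ := exists_retraction_bar P i D
  let U : (Fin D.k → GroupVN Γ) →ₗ[GroupVN Γ] ((Fin i → Γ) →₀ GroupVN Γ) :=
    baseChange (GroupVN.ofGroupAlgebra Γ) u ∘ₗ
      (Finsupp.linearEquivFunOnFinite (GroupVN Γ) (GroupVN Γ) (Fin D.k)).symm.toLinearMap
  have hcyc : ∀ w ∈ LinearMap.range E.vecMulLinear, U w ∈ barCycles Γ i := by
    rintro _ ⟨w, rfl⟩
    have h4 := baseChange_rowVector_eq_zero (GroupVN.ofGroupAlgebra Γ) h1 hEA w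
    cases i with
    | zero => exact Submodule.mem_top
    | succ m =>
      rw [barCycles, LinearMap.mem_ker, ← baseChange_barDifferential]
      exact h4
  let f : LinearMap.range E.vecMulLinear →ₗ[GroupVN Γ] l2Homology Γ i :=
    (((LinearMap.range (barDiff Γ i)).mkQ ∘ₗ U) ∘ₗ
      (LinearMap.range E.vecMulLinear).subtype).codRestrict _ fun w =>
        ⟨U w, hcyc w w.2, rfl⟩
  refine ⟨f, (injective_iff_map_eq_zero f).2 ?_⟩
  rintro ⟨_, ⟨w, rfl⟩⟩ hfw
  have h4 : (LinearMap.range (barDiff Γ i)).mkQ (U (Matrix.vecMul w E)) = 0 :=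
    congrArg Subtype.val hfw
  rw [Submodule.mkQ_apply, Submodule.Quotient.mk_eq_zero, ← baseChange_barDifferential] at h4
  obtain ⟨b, hb⟩ := h4
  exact Subtype.ext (vecMul_eq_zero_of_boundary (GroupVN.ofGroupAlgebra Γ) h2 h3 hE hEA hTE w b hb)

lemma rightShift_mem_ker {Γ : Type} [Group Γ] {k l : ℕ}
    {T : HilbertPow Γ k →L[ℂ] HilbertPow Γ l} (hT : IsEquivariant T) (g : Γ)
    {v : HilbertPow Γ k} (hv : v ∈ LinearMap.ker T.toLinearMap) :
    rightShift g v ∈ LinearMap.ker T.toLinearMap := by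
  have hv' : T v = 0 := hv
  change T (rightShift g v) = 0
  rw [hT, hv']
  rfl

/-- The projection onto a nonzero invariant closed subspace has positive trace. -/
lemma eq_bot_of_trace_starProjection_nonpos {Γ : Type} [Group Γ] {k : ℕ}
    (K : Submodule ℂ (HilbertPow Γ k)) [K.HasOrthogonalProjection]
    (hK : ∀ (g : Γ), ∀ v ∈ K, rightShift g v ∈ K) (h : (trace K.starProjection).re ≤ 0) :
    K = ⊥ := by
  have h1 : (trace K.starProjection).re =
      ∑ i, ‖K.starProjection (basisVec i (1 : Γ))‖ ^ 2 := by
    rw [trace, Complex.re_sum]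
    refine Finset.sum_congr rfl fun i _ => ?_
    rw [← Submodule.inner_starProjection_left_eq_right]
    exact (Submodule.re_inner_starProjection_eq_normSq K _).trans rfl
  have h2 : ∀ i, K.starProjection (basisVec i (1 : Γ)) = 0 := by
    intro i
    rw [h1] at h
    have h3 := (Finset.sum_eq_zero_iff_of_nonneg fun i _ => by positivity).1
      (le_antisymm h (Finset.sum_nonneg fun i _ => by positivity)) i (Finset.mem_univ i)
    simpa using h3
  refine (Submodule.eq_bot_iff K).2 fun v hv => ext_coord fun i g => ?_
  have h3 : basisVec i g = rightShift g (basisVec i (1 : Γ)) := by simp [rightShift_basisVec]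
  rw [← inner_basisVec_left, h3, ← Submodule.starProjection_eq_self_iff.2 hv,
    ← Submodule.inner_starProjection_left_eq_right, IsEquivariant.starProjection hK, h2]
  have h4 : rightShift g (0 : HilbertPow Γ k) = 0 := rfl
  rw [h4, inner_zero_left]
  rfl

/-- If the `ℓ²`-Betti number vanishes then there are no harmonic cochains. The projection onto the
space of harmonic cochains is an idempotent matrix over the group von Neumann algebra whose row
space embeds into the homology, so that its trace is bounded by the Betti number. -/
theorem harmonic_eq_bot {Γ : Type} [Group Γ] (P : CategoryTheory.ProjectiveResolution
      (ModuleCat.of (MonoidAlgebra ℂ Γ) (Representation.trivial ℂ Γ ℂ).asModule)) (i : ℕ)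
    (D : MatrixPresentation (cokernelDiff P.complex i)) (hb : l2Betti Γ i = 0) :
    LinearMap.ker (ofGroupMatrix D.rel).toLinearMap ⊓
      (LinearMap.range (ofGroupMatrix D.mat).toLinearMap)ᗮ = ⊥ := by
  set T := ofGroupMatrix D.rel
  set A := ofGroupMatrix D.mat
  have hT : IsEquivariant T := ofMatrix_isEquivariant _
  have hA : IsEquivariant A := ofMatrix_isEquivariant _
  set K := LinearMap.ker T.toLinearMap ⊓ (LinearMap.range A.toLinearMap)ᗮ with hKdef
  have hKinv : ∀ (g : Γ), ∀ v ∈ K, rightShift g v ∈ K := by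
    rintro g v ⟨hv1, hv2⟩
    refine ⟨rightShift_mem_ker hT g hv1, ?_⟩
    refine (Submodule.mem_orthogonal' _ _).2 ?_
    replace hv2 := (Submodule.mem_orthogonal' _ _).1 hv2
    rintro _ ⟨w, rfl⟩
    rw [inner_rightShift_left]
    exact (congrArg _ (hA g⁻¹ w).symm).trans (hv2 _ ⟨_, rfl⟩)
  have hclosed : IsClosed (K : Set (HilbertPow Γ D.k)) :=
    (ContinuousLinearMap.isClosed_ker T).inter (Submodule.isClosed_orthogonal _)
  have : CompleteSpace K := hclosed.completeSpace_coe
  obtain ⟨E, hE⟩ := exists_ofMatrix (IsEquivariant.starProjection hKinv)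
  refine eq_bot_of_trace_starProjection_nonpos K hKinv ?_
  have hEE : E * E = E := by
    apply ofMatrix_injective
    ext1 v
    rw [ofMatrix_mul, hE]
    exact Submodule.starProjection_eq_self_iff.2 (Submodule.starProjection_apply_mem K v)
  have hEA : E * D.mat.map (GroupVN.ofGroupAlgebra Γ) = 0 := by
    apply ofMatrix_injective
    ext1 v
    rw [ofMatrix_mul, hE]
    have h0 : ofMatrix (0 : Matrix (Fin D.k) (Fin D.l) (GroupVN Γ)) v = 0 := by
      ext1 i
      rw [ofMatrix_apply]
      exact Finset.sum_eq_zero fun j _ => rfl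
    rw [h0, Submodule.starProjection_apply_eq_zero_iff]
    exact Submodule.orthogonal_le inf_le_right (Submodule.le_orthogonal_orthogonal _ ⟨v, rfl⟩)
  have hTE : D.rel.map (GroupVN.ofGroupAlgebra Γ) * E = 0 := by
    apply ofMatrix_injective
    ext1 v
    rw [ofMatrix_mul, hE]
    have h0 : ofMatrix (0 : Matrix (Fin D.m) (Fin D.k) (GroupVN Γ)) v = 0 := by
      ext1 i
      rw [ofMatrix_apply]
      exact Finset.sum_eq_zero fun j _ => rfl
    rw [h0]
    exact (Submodule.starProjection_apply_mem K v).1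
  have h1 : ENNReal.ofReal (∑ i, (vnTrace (E i i)).re) ≤ l2Betti Γ i :=
    le_iSup₂_of_le D.k E (le_iSup₂_of_le hEE
      (exists_injective_l2Homology P i D E hEE hEA hTE) le_rfl)
  rw [hb, nonpos_iff_eq_zero, ENNReal.ofReal_eq_zero] at h1
  rwa [← hE, trace_ofMatrix, Complex.re_sum]

end

/-! ### Harmonic cochains over a subgroup of finite index -/

section

open HilbertPow

/-- If there are no harmonic vectors, every cocycle is a limit of coboundaries. -/
lemma ker_le_closure_range {Γ : Type} [Group Γ] {k l m : ℕ}
    {T : HilbertPow Γ k →L[ℂ] HilbertPow Γ m} {A : HilbertPow Γ l →L[ℂ] HilbertPow Γ k}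
    (hTA : ∀ v, T (A v) = 0)
    (h : LinearMap.ker T.toLinearMap ⊓ (LinearMap.range A.toLinearMap)ᗮ = ⊥) :
    LinearMap.ker T.toLinearMap ≤ (LinearMap.range A.toLinearMap).topologicalClosure := by
  intro v hv
  set U := (LinearMap.range A.toLinearMap).topologicalClosure with hU
  have hUT : U ≤ LinearMap.ker T.toLinearMap := by
    refine Submodule.topologicalClosure_minimal _ ?_ (ContinuousLinearMap.isClosed_ker T)
    rintro _ ⟨w, rfl⟩
    exact hTA w
  have : CompleteSpace U := Submodule.topologicalClosure.completeSpace _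
  have h1 : v - U.starProjection v ∈
      LinearMap.ker T.toLinearMap ⊓ (LinearMap.range A.toLinearMap)ᗮ := by
    refine ⟨Submodule.sub_mem _ hv (hUT (Submodule.starProjection_apply_mem U v)), ?_⟩
    exact Submodule.orthogonal_le (Submodule.le_topologicalClosure _)
      (Submodule.sub_starProjection_mem_orthogonal v)
  rw [h, Submodule.mem_bot, sub_eq_zero] at h1
  rw [h1]
  exact Submodule.starProjection_apply_mem U v

lemma ofGroupMatrix_rel_mat {Γ C Q : Type} [Group Γ] [AddCommGroup C]
    [Module (MonoidAlgebra ℂ Γ) C] [AddCommGroup Q] [Module (MonoidAlgebra ℂ Γ) Q]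
    {d : C →ₗ[MonoidAlgebra ℂ Γ] Q} (D : MatrixPresentation d) (v : HilbertPow Γ D.l) :
    ofGroupMatrix D.rel (ofGroupMatrix D.mat v) = 0 := by
  rw [ofGroupMatrix_apply, ofGroupMatrix_apply, matrixAction_mul, D.rel_mul_mat]
  ext i : 1
  refine (matrixAction_apply _ _ _ i).trans ?_
  simp

/-- Restriction of square summable functions along an injective homomorphism. -/
def ell2.restrict {Γ Γ' : Type} [Group Γ] [Group Γ'] (j : Γ' →* Γ) (hj : Function.Injective j) :
    ell2 Γ →L[ℂ] ell2 Γ' :=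
  LinearMap.mkContinuous
    { toFun := fun f => ⟨fun x => f (j x), (memℓp_gen_iff (p := 2) (by norm_num)).2
        (((memℓp_gen_iff (p := 2) (by norm_num)).1 (lp.memℓp f)).comp_injective hj)⟩
      map_add' := fun _ _ => rfl
      map_smul' := fun _ _ => rfl } 1 (fun f => by
        have hs := (memℓp_gen_iff (p := 2) (by norm_num)).1 (lp.memℓp f)
        rw [one_mul, lp.norm_eq_tsum_rpow (by norm_num), lp.norm_eq_tsum_rpow (by norm_num)]
        refine Real.rpow_le_rpow (tsum_nonneg fun _ => by positivity) ?_ (by norm_num)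
        exact tsum_comp_le_tsum_of_inj hs (fun _ => by positivity) hj)

lemma ell2.restrict_apply {Γ Γ' : Type} [Group Γ] [Group Γ'] (j : Γ' →* Γ)
    (hj : Function.Injective j) (f : ell2 Γ) (x : Γ') : ell2.restrict j hj f x = f (j x) := rfl

/-- Restriction of square summable functions in all coordinates. -/
def HilbertPow.restrict {Γ Γ' : Type} [Group Γ] [Group Γ'] (j : Γ' →* Γ)
    (hj : Function.Injective j) (k : ℕ) : HilbertPow Γ k →L[ℂ] HilbertPow Γ' k :=
  (PiLp.continuousLinearEquiv 2 ℂ fun _ : Fin k => ell2 Γ').symm.toContinuousLinearMap ∘L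
    ContinuousLinearMap.pi fun i => ell2.restrict j hj ∘L PiLp.proj 2 (fun _ => ell2 Γ) i

lemma HilbertPow.restrict_apply {Γ Γ' : Type} [Group Γ] [Group Γ'] (j : Γ' →* Γ)
    (hj : Function.Injective j) {k : ℕ} (v : HilbertPow Γ k) (i : Fin k) :
    HilbertPow.restrict j hj k v i = ell2.restrict j hj (v i) := rfl

lemma bijective_out_mul {Γ Γ' : Type} [Group Γ] [Group Γ'] (j : Γ' →* Γ)
    (hj : Function.Injective j) :
    Function.Bijective fun p : (Γ ⧸ j.range) × Γ' => p.1.out * j p.2 := by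
  constructor
  · rintro ⟨t, g⟩ ⟨t', g'⟩ h
    have ht : t = t' := by
      have h1 := congrArg (QuotientGroup.mk (s := j.range)) h
      simpa [QuotientGroup.mk_mul_of_mem _ (MonoidHom.mem_range.2 ⟨_, rfl⟩)] using h1
    subst ht
    exact Prod.ext rfl (hj (mul_left_cancel h))
  · intro γ
    obtain ⟨⟨_, g, rfl⟩, h⟩ := QuotientGroup.mk_out_eq_mul j.range γ
    refine ⟨(γ, g⁻¹), ?_⟩
    simp [h]

/-- Frobenius reciprocity: for a subgroup of finite index, a homomorphism for the subgroup into its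
`ℓ²`-space is the restriction of a homomorphism into the `ℓ²`-space of the group. -/
lemma exists_coinduced_hom {Γ Γ' C : Type} [Group Γ] [Group Γ'] (j : Γ' →* Γ)
    (hj : Function.Injective j) [j.range.FiniteIndex] [AddCommGroup C]
    [Module (MonoidAlgebra ℂ Γ) C] [Module (MonoidAlgebra ℂ Γ') C]
    (hC : ∀ (g : Γ') (c : ℂ) (x : C),
      MonoidAlgebra.single g c • x = MonoidAlgebra.single (j g) c • x)
    (φ' : C →ₗ[MonoidAlgebra ℂ Γ'] (leftRegular Γ').asModule) :
    ∃ φ : C →ₗ[MonoidAlgebra ℂ Γ] (leftRegular Γ).asModule, ∀ x,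
      (leftRegular Γ').asModuleEquiv (φ' x) =
        ell2.restrict j hj ((leftRegular Γ).asModuleEquiv (φ x)) := by
  classical
  let F : C → Γ' → ℂ := fun x => (leftRegular Γ').asModuleEquiv (φ' x)
  have hF : ∀ (g : Γ') (c : ℂ) x y,
      F (MonoidAlgebra.single (j g) c • x) y = c * F x (g⁻¹ * y) := by
    intro g c x y
    simp only [F]
    rw [← hC, map_smul, Representation.asModuleEquiv_map_smul, Representation.asAlgebraHom_single]
    rfl
  have hFadd : ∀ x y γ, F (x + y) γ = F x γ + F y γ := by
    intro x y γ
    simp only [F, map_add]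
    rfl
  -- equivariance forces the values of the extension, by translation to the identity
  let f : C → Γ → ℂ := fun x γ => F (MonoidAlgebra.single γ⁻¹ (1 : ℂ) • x) 1
  have hf : ∀ x (t : Γ) (g : Γ'),
      f x (t * j g) = F (MonoidAlgebra.single t⁻¹ (1 : ℂ) • x) g := by
    intro x t g
    have h1 := hF g⁻¹ 1 (MonoidAlgebra.single t⁻¹ (1 : ℂ) • x) 1
    rw [← mul_smul, MonoidAlgebra.single_mul_single] at h1
    simpa [f] using h1
  have hmem : ∀ x, Memℓp (f x) 2 := by
    intro x
    refine (memℓp_gen_iff (p := 2) (by norm_num)).2 ?_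
    -- over each of the finitely many cosets the sum is that of an element of the smaller space
    rw [← (Equiv.ofBijective _ (bijective_out_mul j hj)).summable_iff]
    refine (summable_prod_of_nonneg fun p => Real.rpow_nonneg (norm_nonneg (f x _)) _).2
      ⟨fun t => ?_, Summable.of_finite⟩
    refine ((memℓp_gen_iff (p := 2) (by norm_num)).1 (lp.memℓp ((leftRegular Γ').asModuleEquiv
      (φ' (MonoidAlgebra.single t.out⁻¹ (1 : ℂ) • x))))).congr fun g => ?_
    exact congrArg (fun z => ‖z‖ ^ (2 : ENNReal).toReal) (hf x t.out g).symm
  let ψ : C →+ ell2 Γ :=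
    { toFun := fun x => ⟨f x, hmem x⟩
      map_zero' := by
        ext γ
        change F _ 1 = 0
        have h := hFadd 0 0 1
        rw [smul_zero]
        simpa using h
      map_add' := fun x y => by
        ext γ
        change F _ 1 = F _ 1 + F _ 1
        rw [smul_add, hFadd] }
  refine ⟨linearOfEquivariant ((leftRegular Γ).asModuleEquiv.symm.toAddEquiv.toAddMonoidHom.comp ψ)
    fun g c x => ?_, fun x => ?_⟩
  · apply (leftRegular Γ).asModuleEquiv.injective
    rw [Representation.asModuleEquiv_map_smul, Representation.asAlgebraHom_single]
    ext γ
    change F _ 1 = c * F (MonoidAlgebra.single (g⁻¹ * γ)⁻¹ (1 : ℂ) • x) 1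
    have h := hF 1 c (MonoidAlgebra.single (g⁻¹ * γ)⁻¹ (1 : ℂ) • x) 1
    rw [inv_one, one_mul] at h
    rw [← h, ← mul_smul, ← mul_smul, MonoidAlgebra.single_mul_single,
      MonoidAlgebra.single_mul_single]
    simp
  · ext g
    have h := hf x 1 g
    rw [one_mul, inv_one] at h
    change F x g = f x (j g)
    rw [h]
    change _ = F ((1 : MonoidAlgebra ℂ Γ) • x) g
    rw [one_smul]

/-- The vanishing of the reduced cohomology with `ℓ²`-coefficients passes to subgroups of finite
index: a cocycle for the subgroup extends to one for the group, and restricting an approximation of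
the extension by coboundaries gives an approximation of the cocycle. -/
theorem ker_le_closure_range_of_finiteIndex {Γ Γ' C Q : Type} [Group Γ] [Group Γ'] (j : Γ' →* Γ)
    (hj : Function.Injective j) [j.range.FiniteIndex] [AddCommGroup C]
    [Module (MonoidAlgebra ℂ Γ) C] [Module (MonoidAlgebra ℂ Γ') C] [AddCommGroup Q]
    [Module (MonoidAlgebra ℂ Γ) Q] [Module (MonoidAlgebra ℂ Γ') Q]
    (hC : ∀ (g : Γ') (c : ℂ) (x : C),
      MonoidAlgebra.single g c • x = MonoidAlgebra.single (j g) c • x)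
    (hQ : ∀ (g : Γ') (c : ℂ) (x : Q),
      MonoidAlgebra.single g c • x = MonoidAlgebra.single (j g) c • x)
    {d : C →ₗ[MonoidAlgebra ℂ Γ] Q} {d' : C →ₗ[MonoidAlgebra ℂ Γ'] Q} (hd : ∀ x, d' x = d x)
    (D : MatrixPresentation d) (D' : MatrixPresentation d')
    (h : LinearMap.ker (ofGroupMatrix D.rel).toLinearMap ≤
      (LinearMap.range (ofGroupMatrix D.mat).toLinearMap).topologicalClosure) :
    LinearMap.ker (ofGroupMatrix D'.rel).toLinearMap ≤
      (LinearMap.range (ofGroupMatrix D'.mat).toLinearMap).topologicalClosure := by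
  intro v hv
  have hv' : v.ofLp ∈ LinearMap.ker (matrixAction (leftRegular Γ') D'.rel) := by
    have h1 : ofGroupMatrix D'.rel v = 0 := hv
    rw [ofGroupMatrix_apply] at h1
    exact congrArg WithLp.ofLp h1
  obtain ⟨φ', hφ'⟩ := D'.exists_hom_of_mem_ker _ hv'
  obtain ⟨φ, hφ⟩ := exists_coinduced_hom j hj hC φ'
  choose r hr using fun a => D.span_gen (D'.gen a)
  -- the values on the generators over the subgroup are computed from those over the group
  have key : ∀ χ : C →ₗ[MonoidAlgebra ℂ Γ] (leftRegular Γ).asModule,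
      ofGroupMatrix (Matrix.of r)
        (WithLp.toLp 2 fun b => (leftRegular Γ).asModuleEquiv (χ (D.gen b))) =
      WithLp.toLp 2 fun a => (leftRegular Γ).asModuleEquiv (χ (D'.gen a)) := by
    intro χ
    rw [ofGroupMatrix_apply]
    congr 1
    funext a
    rw [matrixAction_apply, ← hr]
    simp [map_sum, Representation.asModuleEquiv_map_smul]
  have hmem : (WithLp.toLp 2 fun b => (leftRegular Γ).asModuleEquiv (φ (D.gen b))) ∈
      (LinearMap.range (ofGroupMatrix D.mat).toLinearMap).topologicalClosure := by
    apply h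
    rw [LinearMap.mem_ker]
    refine (ofGroupMatrix_apply D.rel _).trans ?_
    have h1 : matrixAction (leftRegular Γ) D.rel _ = 0 := D.hom_mem_ker (leftRegular Γ) φ
    exact congrArg (WithLp.toLp 2) h1
  have hv2 : v = (HilbertPow.restrict j hj D'.k ∘L ofGroupMatrix (Matrix.of r))
      (WithLp.toLp 2 fun b => (leftRegular Γ).asModuleEquiv (φ (D.gen b))) := by
    rw [ContinuousLinearMap.comp_apply, key]
    ext a : 1
    rw [HilbertPow.restrict_apply]
    change v a = ell2.restrict j hj ((leftRegular Γ).asModuleEquiv (φ (D'.gen a)))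
    rw [← hφ, hφ', LinearEquiv.apply_symm_apply]
  rw [hv2]
  refine map_mem_closure (ContinuousLinearMap.continuous _) hmem ?_
  rintro _ ⟨w, rfl⟩
  obtain ⟨ψ, hψ⟩ := D.exists_comp_of_mem_range (leftRegular Γ)
    (v := matrixAction (leftRegular Γ) D.mat w.ofLp) ⟨_, rfl⟩
  let ψ' : Q →ₗ[MonoidAlgebra ℂ Γ'] (leftRegular Γ').asModule :=
    linearOfEquivariant ((leftRegular Γ').asModuleEquiv.symm.toAddEquiv.toAddMonoidHom.comp
      ((ell2.restrict j hj).toLinearMap.toAddMonoidHom.comp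
        ((leftRegular Γ).asModuleEquiv.toAddEquiv.toAddMonoidHom.comp ψ.toAddMonoidHom)))
      fun g c x => by
        apply (leftRegular Γ').asModuleEquiv.injective
        rw [Representation.asModuleEquiv_map_smul, Representation.asAlgebraHom_single, hQ]
        change ell2.restrict j hj ((leftRegular Γ).asModuleEquiv
          (ψ (MonoidAlgebra.single (j g) c • x))) = c • leftRegular Γ' g
          (ell2.restrict j hj ((leftRegular Γ).asModuleEquiv (ψ x)))
        rw [map_smul, Representation.asModuleEquiv_map_smul, Representation.asAlgebraHom_single]
        ext y
        change c * ((leftRegular Γ).asModuleEquiv (ψ x)) ((j g)⁻¹ * j y) =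
          c * ((leftRegular Γ).asModuleEquiv (ψ x)) (j (g⁻¹ * y))
        rw [map_mul, map_inv]
  obtain ⟨u, hu⟩ := D'.comp_mem_range (leftRegular Γ') ψ'
  refine ⟨WithLp.toLp 2 u, ?_⟩
  refine (ofGroupMatrix_apply D'.mat _).trans ?_
  have hw : ofGroupMatrix D.mat w = WithLp.toLp 2 fun b =>
      (leftRegular Γ).asModuleEquiv ((ψ ∘ₗ d) (D.gen b)) := by
    rw [ofGroupMatrix_apply]
    congr 1
    funext b
    rw [LinearMap.comp_apply, hψ, LinearEquiv.apply_symm_apply]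
  change _ = HilbertPow.restrict j hj D'.k (ofGroupMatrix (Matrix.of r) (ofGroupMatrix D.mat w))
  rw [hw, key]
  ext a : 1
  rw [HilbertPow.restrict_apply]
  refine (congrFun hu a).trans ?_
  rw [hd]
  rfl

/-- If the harmonic space vanishes, the von Neumann ranks of the two matrices of a presentation add
up to the number of generators. -/
lemma trace_rel_add_trace_mat {Γ C Q : Type} [Group Γ] [AddCommGroup C]
    [Module (MonoidAlgebra ℂ Γ) C] [AddCommGroup Q] [Module (MonoidAlgebra ℂ Γ) Q]
    {d : C →ₗ[MonoidAlgebra ℂ Γ] Q} (D : MatrixPresentation d)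
    (h : LinearMap.ker (ofGroupMatrix D.rel).toLinearMap ≤
      (LinearMap.range (ofGroupMatrix D.mat).toLinearMap).topologicalClosure)
    (Z : Subgroup Γ) (hZ : Z = ⊥) (χ : Z →* ℂˣ) :
    twistedRank Z χ D.rel + twistedRank Z χ D.mat = D.k := by
  have hclosed : (LinearMap.range (ofGroupMatrix D.mat).toLinearMap).topologicalClosure =
      LinearMap.ker (ofGroupMatrix D.rel).toLinearMap := by
    refine le_antisymm (Submodule.topologicalClosure_minimal _ ?_
      (ContinuousLinearMap.isClosed_ker _)) h
    rintro _ ⟨w, rfl⟩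
    exact ofGroupMatrix_rel_mat D w
  have : CompleteSpace (LinearMap.range (ofGroupMatrix D.rel).toLinearMap).topologicalClosure :=
    Submodule.topologicalClosure.completeSpace _
  have h1 := trace_ker_add_trace_range (ofGroupMatrix D.rel) (ofMatrix_isEquivariant _)
  rw [twistedRank_bot Z hZ, twistedRank_bot Z hZ, ← Complex.add_re, add_comm]
  simp only [hclosed]
  rw [h1, Complex.natCast_re]

end

/-! ### The centre of a semi-simple group -/

section Center

variable {N : ℕ}

/-- Left translation by `a` substitutes linear polynomials for the matrix entries, so that it is
continuous for the Zariski topology. -/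
lemma evalAt_bind₁_mul (a g : GL (Fin N) ℂ) (p : MvPolynomial (Fin N × Fin N) ℂ) :
    evalAt (MvPolynomial.bind₁ (fun ij : Fin N × Fin N => ∑ k,
      MvPolynomial.C ((a : Matrix (Fin N) (Fin N) ℂ) ij.1 k) * MvPolynomial.X (k, ij.2)) p) g =
      evalAt p (a * g) := by
  rw [evalAt, evalAt, MvPolynomial.eval, MvPolynomial.eval₂Hom_bind₁]
  congr 2
  funext ij
  simp [Matrix.mul_apply]

/-- The prime ideal of the polynomials vanishing at a matrix, as a point of the prime spectrum. The
Zariski topology is the one induced by this map. -/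
def zariskiPoint (g : GL (Fin N) ℂ) : PrimeSpectrum (MvPolynomial (Fin N × Fin N) ℂ) :=
  ⟨RingHom.ker (MvPolynomial.eval fun ij => (g : Matrix (Fin N) (Fin N) ℂ) ij.1 ij.2),
    RingHom.ker_isPrime _⟩

lemma isZariskiClosed_preimage_zariskiPoint
    {S : Set (PrimeSpectrum (MvPolynomial (Fin N × Fin N) ℂ))} (hS : IsClosed S) :
    IsZariskiClosed (zariskiPoint ⁻¹' S) := by
  obtain ⟨I, rfl⟩ := (PrimeSpectrum.isClosed_iff_zeroLocus S).1 hS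
  exact ⟨I, rfl⟩

lemma IsZariskiClosed.exists_isClosed {S : Set (GL (Fin N) ℂ)} (hS : IsZariskiClosed S) :
    ∃ S' : Set (PrimeSpectrum (MvPolynomial (Fin N × Fin N) ℂ)), IsClosed S' ∧
      zariskiPoint ⁻¹' S' = S := by
  obtain ⟨I, rfl⟩ := hS
  exact ⟨_, PrimeSpectrum.isClosed_zeroLocus I, rfl⟩

lemma IsZariskiClosed.inter {A B : Set (GL (Fin N) ℂ)} (hA : IsZariskiClosed A)
    (hB : IsZariskiClosed B) : IsZariskiClosed (A ∩ B) := by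
  obtain ⟨I, rfl⟩ := hA
  obtain ⟨J, rfl⟩ := hB
  refine ⟨I ∪ J, ?_⟩
  ext g
  simp only [Set.mem_inter_iff, Set.mem_ofPred_eq, Set.mem_union, or_imp, forall_and]

lemma isZariskiClosed_commuting (S : Set (GL (Fin N) ℂ)) :
    IsZariskiClosed {g : GL (Fin N) ℂ | ∀ h ∈ S, h * g = g * h} := by
  refine ⟨{p | ∃ h ∈ S, ∃ i j, p = ∑ k,
    (MvPolynomial.C ((h : Matrix (Fin N) (Fin N) ℂ) i k) * MvPolynomial.X (k, j) -
      MvPolynomial.C ((h : Matrix (Fin N) (Fin N) ℂ) k j) * MvPolynomial.X (i, k))}, ?_⟩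
  have key : ∀ (g h : GL (Fin N) ℂ) i j, evalAt (∑ k,
      (MvPolynomial.C ((h : Matrix (Fin N) (Fin N) ℂ) i k) * MvPolynomial.X (k, j) -
        MvPolynomial.C ((h : Matrix (Fin N) (Fin N) ℂ) k j) * MvPolynomial.X (i, k))) g =
      (h * g : GL (Fin N) ℂ) i j - (g * h : GL (Fin N) ℂ) i j := by
    intro g h i j
    simp [evalAt, Matrix.mul_apply, Finset.sum_sub_distrib, mul_comm]
  ext g
  constructor
  · rintro hg _ ⟨h, hh, i, j, rfl⟩
    rw [key, hg h hh, sub_self]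
  · intro hg h hh
    ext i j
    rw [← sub_eq_zero, ← key]
    exact hg _ ⟨h, hh, i, j, rfl⟩

/-- The connected component of the identity of the centre is a connected solvable normal closed
subgroup, hence trivial; the Zariski topology being Noetherian, the centre has only finitely many
components. -/
theorem IsSemisimpleGroup.finite_center {G : Subgroup (GL (Fin N) ℂ)} (hG : IsSemisimpleGroup G) :
    Finite (Subgroup.center G) := by
  let ev : Subgroup.center G → PrimeSpectrum (MvPolynomial (Fin N × Fin N) ℂ) :=
    fun z => zariskiPoint (z : G)
  let _ : TopologicalSpace (Subgroup.center G) := TopologicalSpace.induced ev inferInstance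
  have hind : Topology.IsInducing ev := ⟨rfl⟩
  have hnoeth : TopologicalSpace.NoetherianSpace (Subgroup.center G) := hind.noetherianSpace
  have hpre : ∀ A : Set (GL (Fin N) ℂ), IsZariskiClosed A →
      IsClosed {z : Subgroup.center G | ((z : G) : GL (Fin N) ℂ) ∈ A} := by
    intro A hA
    obtain ⟨S', hS', rfl⟩ := hA.exists_isClosed
    exact hS'.preimage hind.continuous
  have hmul : ∀ a : Subgroup.center G, Continuous fun z => a * z := by
    intro a
    refine continuous_iff_isClosed.2 fun S hS => ?_
    obtain ⟨S', hS', rfl⟩ := hind.isClosed_iff.1 hS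
    obtain ⟨I, rfl⟩ := (PrimeSpectrum.isClosed_iff_zeroLocus S').1 hS'
    refine hpre {g | ((a : G) : GL (Fin N) ℂ) * g ∈ {g | ∀ p ∈ I, evalAt p g = 0}}
      ⟨(MvPolynomial.bind₁ fun ij : Fin N × Fin N => ∑ k,
        MvPolynomial.C ((((a : G) : GL (Fin N) ℂ) : Matrix (Fin N) (Fin N) ℂ) ij.1 k) *
          MvPolynomial.X (k, ij.2)) '' I, ?_⟩
    ext g
    simp only [Set.mem_ofPred_eq, Set.forall_mem_image, evalAt_bind₁_mul]
  have hcomp : ∀ a x : Subgroup.center G, x ∈ connectedComponent (1 : Subgroup.center G) →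
      a * x ∈ connectedComponent a := by
    intro a x hx
    have h1 := (hmul a).image_connectedComponent_subset 1
    rw [mul_one] at h1
    exact h1 ⟨x, hx, rfl⟩
  -- left translations permute the components, so the one of the identity is a subgroup
  let X : Subgroup (Subgroup.center G) :=
    { carrier := connectedComponent 1
      one_mem' := mem_connectedComponent
      mul_mem' := fun {a b} ha hb => by
        rw [connectedComponent_eq ha]
        exact hcomp a b hb
      inv_mem' := fun {a} ha => by
        have h1 := (hmul a⁻¹).image_connectedComponent_subset a
        rw [inv_mul_cancel] at h1
        refine h1 ⟨1, ?_, mul_one _⟩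
        rw [← connectedComponent_eq ha]
        exact mem_connectedComponent }
  let R : Subgroup (GL (Fin N) ℂ) := X.map (G.subtype.comp (Subgroup.center G).subtype)
  have hR : R = ⊥ := by
    refine hG.radical_trivial R ?_ ?_ ?_ ?_ ?_
    · rintro _ ⟨x, -, rfl⟩
      exact (x : G).2
    · obtain ⟨S', hS', hX⟩ := hind.isClosed_iff.1
        (isClosed_connectedComponent (x := (1 : Subgroup.center G)))
      have : (R : Set (GL (Fin N) ℂ)) = zariskiPoint ⁻¹' S' ∩
          ((G : Set (GL (Fin N) ℂ)) ∩ {g : GL (Fin N) ℂ | ∀ h ∈ (G : Set _), h * g = g * h}) := by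
        ext g
        constructor
        · rintro ⟨x, hx, rfl⟩
          refine ⟨?_, (x : G).2, fun h hh => ?_⟩
          · have hx' : x ∈ ev ⁻¹' S' := by rw [hX]; exact hx
            exact hx'
          · exact congrArg Subtype.val (Subgroup.mem_center_iff.1 x.2 ⟨h, hh⟩)
        · rintro ⟨h1, h2, h3⟩
          refine ⟨⟨⟨g, h2⟩, Subgroup.mem_center_iff.2 fun h => Subtype.ext (h3 h h.2)⟩, ?_, rfl⟩
          change _ ∈ connectedComponent _
          rw [← hX]
          exact h1
      rw [this]
      exact (isZariskiClosed_preimage_zariskiPoint hS').inter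
        (hG.closed.inter (isZariskiClosed_commuting _))
    · refine ⟨⟨1, R.one_mem⟩, fun A B hA hB hAB hdis => ?_⟩
      have hc := isPreconnected_closed_iff.1
        (isPreconnected_connectedComponent (x := (1 : Subgroup.center G))) _ _
        (hpre A hA) (hpre B hB) fun x hx => hAB ⟨x, hx, rfl⟩
      by_contra! hcon
      obtain ⟨⟨_, ⟨x, hx, rfl⟩, hxA⟩, ⟨_, ⟨y, hy, rfl⟩, hyB⟩⟩ :=
        And.intro (Set.not_subset.1 hcon.1) (Set.not_subset.1 hcon.2)
      obtain ⟨z, hz, hzA, hzB⟩ := hc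
        ⟨y, hy, (hAB ⟨y, hy, rfl⟩).resolve_right hyB⟩ ⟨x, hx, (hAB ⟨x, hx, rfl⟩).resolve_left hxA⟩
      have : ((z : G) : GL (Fin N) ℂ) ∈ (R : Set (GL (Fin N) ℂ)) ∩ (A ∩ B) :=
        ⟨⟨z, hz, rfl⟩, hzA, hzB⟩
      rw [hdis] at this
      exact this
    · refine Group.isSolvable_of_comm ?_
      rintro ⟨_, x, -, rfl⟩ ⟨_, y, -, rfl⟩
      exact Subtype.ext (congrArg Subtype.val (Subgroup.mem_center_iff.1 y.2 (x : G)) :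
        ((x : G) : GL (Fin N) ℂ) * ((y : G) : GL (Fin N) ℂ) = (y : G) * (x : G))
    · refine ⟨?_⟩
      rintro n ⟨x, hx, hxn⟩ g
      have hn : n = (x : G) := Subtype.ext hxn.symm
      have h1 : g * n * g⁻¹ = n := by
        rw [hn, Subgroup.mem_center_iff.1 x.2 g, mul_inv_cancel_right]
      rw [h1]
      exact ⟨x, hx, hxn⟩
  have hone : ∀ x ∈ connectedComponent (1 : Subgroup.center G), x = 1 := by
    intro x hx
    have h1 : ((x : G) : GL (Fin N) ℂ) ∈ R := ⟨x, hx, rfl⟩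
    rw [hR, Subgroup.mem_bot] at h1
    exact Subtype.ext (Subtype.ext h1)
  have hsing : ∀ a x : Subgroup.center G, x ∈ connectedComponent a → x = a := by
    intro a x hx
    have h1 := (hmul a⁻¹).image_connectedComponent_subset a
    rw [inv_mul_cancel] at h1
    have h2 := hone _ (h1 ⟨x, hx, rfl⟩)
    exact (inv_mul_eq_one.1 h2).symm
  have hfin := (TopologicalSpace.NoetherianSpace.finite_irreducibleComponents
    (α := Subgroup.center G)).to_subtype
  refine Finite.of_injective (fun z : Subgroup.center G =>
    (⟨irreducibleComponent z, irreducibleComponent_mem_irreducibleComponents z⟩ :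
      irreducibleComponents (Subgroup.center G))) fun x y hxy => ?_
  have h1 : irreducibleComponent x = irreducibleComponent y := congrArg Subtype.val hxy
  apply hsing y x
  apply isIrreducible_irreducibleComponent.isPreirreducible.isPreconnected
    |>.subset_connectedComponent (mem_irreducibleComponent (x := y))
  rw [← h1]
  exact mem_irreducibleComponent

lemma subgroupOf_center_eq_bot {G : Type} [Group G] [Finite (Subgroup.center G)] (Γ : Subgroup G)
    (htf : ∀ g : Γ, g ≠ 1 → ¬ IsOfFinOrder g) : (Subgroup.center G).subgroupOf Γ = ⊥ := by
  refine (Subgroup.eq_bot_iff_forall _).2 fun g hg => ?_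
  by_contra hne
  apply htf g hne
  have h1 : IsOfFinOrder (⟨g, hg⟩ : Subgroup.center G) := isOfFinOrder_of_finite _
  have h2 := (Subgroup.center G).subtype.isOfFinOrder h1
  exact (Γ.subtype_injective.isOfFinOrder_iff (f := Γ.subtype)).1 h2

end Center

/-- Schur's lemma: the centre acts through a character on an irreducible representation. -/
theorem exists_hasCentralCharacter {N : ℕ} {G : Subgroup (GL (Fin N) ℂ)} {W : Type}
    [AddCommGroup W] [Module ℂ W] [FiniteDimensional ℂ W] (ρ : Representation ℂ G W)
    (hρ : ρ.IsIrreducible) : ∃ χ : Subgroup.center G →* ℂˣ, HasCentralCharacter ρ χ := by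
  have hscalar : ∀ z : Subgroup.center G, ∃ c : ℂ, ∀ w, ρ (z : G) w = c • w := by
    intro z
    obtain ⟨c, hc⟩ :=
      (Representation.IsIrreducible.algebraMap_intertwiningMap_bijective_of_isAlgClosed
      (ρ := ρ)).2 ((ρ (z : G)).intertwiningMap_of_isIntertwiningMap ρ ρ fun g v => by
        rw [← Module.End.mul_apply, ← Module.End.mul_apply, ← map_mul, ← map_mul,
          Subgroup.mem_center_iff.1 z.2 g])
    refine ⟨c, fun w => ?_⟩
    have h1 := congrArg (fun f : Representation.IntertwiningMap ρ ρ => f.toLinearMap w) hc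
    exact h1.symm
  choose c hc using hscalar
  have : Nontrivial W := by
    by_contra h
    rw [not_nontrivial_iff_subsingleton] at h
    have := hρ.toNontrivial
    obtain ⟨a, b, hab⟩ := this
    refine hab (SetLike.ext fun x => ?_)
    rw [Subsingleton.elim x 0]
    exact ⟨fun _ => zero_mem b.toSubmodule, fun _ => zero_mem a.toSubmodule⟩
  obtain ⟨w, hw⟩ := exists_ne (0 : W)
  have hinj : ∀ a b : ℂ, a • w = b • w → a = b := fun a b h => smul_left_injective ℂ hw h
  let χ : Subgroup.center G →* ℂ :=
    { toFun := c
      map_one' := hinj _ _ (by rw [← hc]; simp)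
      map_mul' := fun x y => hinj _ _ (by rw [← hc, mul_smul, ← hc, ← hc]; simp) }
  exact ⟨χ.toHomUnits, fun z w => by rw [MonoidHom.coe_toHomUnits]; exact hc z w⟩

/-! ### Group algebras of subgroups of finite index -/

section

open CategoryTheory

lemma smul_eq_mapDomain_smul {Γ Γ' P : Type} [Group Γ] [Group Γ'] (j : Γ' →* Γ)
    [AddCommGroup P] [Module (MonoidAlgebra ℂ Γ) P] [Module (MonoidAlgebra ℂ Γ') P]
    (hP : ∀ (g : Γ') (c : ℂ) (x : P),
      MonoidAlgebra.single g c • x = MonoidAlgebra.single (j g) c • x)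
    (a : MonoidAlgebra ℂ Γ') (x : P) : a • x = MonoidAlgebra.mapDomainRingHom ℂ j a • x := by
  induction a using MonoidAlgebra.induction_linear with
  | zero => simp
  | add a b ha hb => rw [add_smul, map_add, add_smul, ha, hb]
  | single g c => rw [hP, MonoidAlgebra.mapDomainRingHom_apply, MonoidAlgebra.mapDomain_single]

/-- The group algebra is a free module of finite rank over the group algebra of a subgroup of finite
index, with the inverses of coset representatives as a basis; so finitely generated projective
modules remain so. -/
lemma finite_and_projective_of_finiteIndex {Γ Γ' P : Type} [Group Γ] [Group Γ'] (j : Γ' →* Γ)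
    (hj : Function.Injective j) [j.range.FiniteIndex] [AddCommGroup P]
    [Module (MonoidAlgebra ℂ Γ) P] [Module (MonoidAlgebra ℂ Γ') P]
    (hP : ∀ (g : Γ') (c : ℂ) (x : P),
      MonoidAlgebra.single g c • x = MonoidAlgebra.single (j g) c • x)
    [Module.Finite (MonoidAlgebra ℂ Γ) P] [Module.Projective (MonoidAlgebra ℂ Γ) P] :
    Module.Finite (MonoidAlgebra ℂ Γ') P ∧ Module.Projective (MonoidAlgebra ℂ Γ') P := by
  classical
  have : Fintype (Γ ⧸ j.range) := Fintype.ofFinite _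
  have hinj : ∀ t : Γ ⧸ j.range, Function.Injective fun h : Γ' => j h * t.out⁻¹ :=
    fun t a b h => hj (mul_right_cancel h)
  let s : Γ ⧸ j.range → MonoidAlgebra ℂ Γ →+ MonoidAlgebra ℂ Γ' := fun t =>
    MonoidAlgebra.comapDomainAddMonoidHom _ (hinj t)
  have hsum : ∀ y : MonoidAlgebra ℂ Γ, ∑ t, MonoidAlgebra.mapDomainRingHom ℂ j (s t y) *
      MonoidAlgebra.single t.out⁻¹ 1 = y := by
    intro y
    induction y using MonoidAlgebra.induction_linear with
    | zero => simp
    | add a b ha hb =>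
      conv_rhs => rw [← ha, ← hb, ← Finset.sum_add_distrib]
      simp only [map_add, add_mul]
    | single g c =>
      obtain ⟨⟨t₀, h⟩, hg⟩ := (bijective_out_mul j hj).2 g⁻¹
      have hg' : g = j h⁻¹ * t₀.out⁻¹ := by
        rw [map_inv, ← mul_inv_rev, ← inv_inv g, ← hg]
      rw [Finset.sum_eq_single t₀]
      · have h1 : s t₀ (MonoidAlgebra.single g c) = MonoidAlgebra.single h⁻¹ c := by
          rw [hg']
          exact MonoidAlgebra.comapDomain_single_map _ (hinj t₀) h⁻¹ c
        rw [h1, MonoidAlgebra.mapDomainRingHom_apply, MonoidAlgebra.mapDomain_single,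
          MonoidAlgebra.single_mul_single, mul_one, ← hg']
      · intro t _ ht
        have h1 : s t (MonoidAlgebra.single g c) = 0 := by
          refine MonoidAlgebra.comapDomain_single_of_not_mem_range ?_ (hinj t)
          rintro ⟨h', hh'⟩
          refine ht (congrArg Prod.fst ((bijective_out_mul j hj).1
            (a₁ := (t, h'⁻¹)) (a₂ := (t₀, h)) ?_))
          refine Eq.trans ?_ hg.symm
          rw [← hh']
          simp
        rw [h1, map_zero, zero_mul]
      · simp
  have hs : ∀ (t : Γ ⧸ j.range) (g : Γ') (c : ℂ) (y : MonoidAlgebra ℂ Γ),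
      s t (MonoidAlgebra.single (j g) c * y) = MonoidAlgebra.single g c * s t y := by
    intro t g c y
    ext h
    rw [MonoidAlgebra.coeff_single_mul_apply]
    change (MonoidAlgebra.single (j g) c * y).coeff (j h * t.out⁻¹) =
      c * y.coeff (j (g⁻¹ * h) * t.out⁻¹)
    rw [MonoidAlgebra.coeff_single_mul_apply, map_mul j, map_inv j, mul_assoc]
  obtain ⟨n, q, hq⟩ := Module.Finite.exists_fin' (MonoidAlgebra ℂ Γ) P
  obtain ⟨σ, hσ⟩ := Module.projective_lifting_property q LinearMap.id hq
  let S : P →ₗ[MonoidAlgebra ℂ Γ'] (Fin n × (Γ ⧸ j.range) → MonoidAlgebra ℂ Γ') :=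
    linearOfEquivariant
      { toFun := fun x p => s p.2 (σ x p.1)
        map_zero' := by ext; simp
        map_add' := fun x y => by ext; simp }
      fun g c x => by
        funext p
        rw [hP]
        change s p.2 (σ (MonoidAlgebra.single (j g) c • x) p.1) = _ * s p.2 (σ x p.1)
        rw [map_smul, Pi.smul_apply, smul_eq_mul, hs]
  let L : (Fin n × (Γ ⧸ j.range) → MonoidAlgebra ℂ Γ') →ₗ[MonoidAlgebra ℂ Γ'] P :=
    Fintype.linearCombination _ fun p => MonoidAlgebra.single p.2.out⁻¹ (1 : ℂ) •
      q (Pi.single p.1 1)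
  have hLS : L ∘ₗ S = LinearMap.id := by
    ext x
    simp only [LinearMap.comp_apply, L, Fintype.linearCombination_apply, LinearMap.id_apply]
    rw [Fintype.sum_prod_type]
    have h1 : ∀ (i : Fin n) (t : Γ ⧸ j.range), S x (i, t) • MonoidAlgebra.single t.out⁻¹ (1 : ℂ) •
        q (Pi.single i 1) = (MonoidAlgebra.mapDomainRingHom ℂ j (s t (σ x i)) *
          MonoidAlgebra.single t.out⁻¹ 1) • q (Pi.single i 1) := by
      intro i t
      rw [smul_eq_mapDomain_smul j hP, mul_smul]
      rfl
    simp only [h1, ← Finset.sum_smul, hsum]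
    have h2 : q (σ x) = x := LinearMap.congr_fun hσ x
    conv_rhs => rw [← h2, ← Finset.univ_sum_single (σ x), map_sum]
    refine Finset.sum_congr rfl fun i _ => ?_
    rw [← map_smul, ← Pi.single_smul, smul_eq_mul, mul_one]
  exact ⟨Module.Finite.of_surjective L fun x => ⟨S x, LinearMap.congr_fun hLS x⟩,
    Module.Projective.of_split S L hLS⟩

end

/-! ### The bound on the cohomology -/

section

open CategoryTheory

lemma finitePresentation_cokernelModule {R : Type} [Ring R] {P₁ P₀ : Type} [AddCommGroup P₁]
    [Module R P₁] [AddCommGroup P₀] [Module R P₀] {C : Type} [AddCommGroup C] [Module R C]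
    [Module.Finite R P₁] [Module.Finite R P₀] [Module.Projective R P₀] (f : P₁ →ₗ[R] P₀)
    (q : P₀ →ₗ[R] C) (hq : Function.Surjective q) (hf : LinearMap.range f = LinearMap.ker q) :
    Module.FinitePresentation R C := by
  have := Module.finitePresentation_of_projective R P₀
  refine Module.finitePresentation_of_surjective q hq ?_
  rw [← hf, LinearMap.range_eq_map]
  exact Module.Finite.fg_top.map f

/-- The data that bound the cohomology in degree `i` in terms of a subgroup of finite index: two
matrices over its group algebra whose von Neumann ranks add up to the number `k` of generators of
the module of `i`-chains modulo boundaries. -/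
theorem exists_matrices {Γ Γ' : Type} [Group Γ] [Group Γ'] (j : Γ' →* Γ)
    (hj : Function.Injective j) [j.range.FiniteIndex] {n i : ℕ} (hFP : IsTypeFP Γ (n + 1))
    (hi : i ≤ n) (hb : l2Betti Γ i = 0) :
    ∃ (k m l : ℕ) (T : Matrix (Fin m) (Fin k) (MonoidAlgebra ℂ Γ'))
      (A : Matrix (Fin k) (Fin l) (MonoidAlgebra ℂ Γ')),
      (∀ (Z : Subgroup Γ') (χ : Z →* ℂˣ), Z = ⊥ → twistedRank Z χ T + twistedRank Z χ A = k) ∧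
      ∀ (W : Type) [AddCommGroup W] [Module ℂ W] [FiniteDimensional ℂ W]
        (ρ : Representation ℂ Γ W) (σ : Representation ℂ Γ' W), (∀ g, σ g = ρ (j g)) →
        FiniteDimensional ℂ (groupCohomology (Rep.of ρ) i) ∧
        Module.finrank ℂ (groupCohomology (Rep.of ρ) i) +
          Module.finrank ℂ (LinearMap.range (matrixAction σ A)) ≤
        Module.finrank ℂ (LinearMap.ker (matrixAction σ T)) := by
  obtain ⟨P, hP⟩ := hFP
  have hproj : ∀ a, Module.Projective (MonoidAlgebra ℂ Γ) (P.complex.X a) := fun a =>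
    (IsProjective.iff_projective _).2 (P.projective a)
  let instX : ∀ a, Module (MonoidAlgebra ℂ Γ') (P.complex.X a) := fun a =>
    Module.compHom _ (MonoidAlgebra.mapDomainRingHom ℂ j)
  let instC : Module (MonoidAlgebra ℂ Γ') (cokernelModule P.complex i) :=
    Module.compHom _ (MonoidAlgebra.mapDomainRingHom ℂ j)
  have hX : ∀ a (g : Γ') (c : ℂ) (x : P.complex.X a),
      MonoidAlgebra.single g c • x = MonoidAlgebra.single (j g) c • x := by
    intro a g c x
    change MonoidAlgebra.mapDomainRingHom ℂ j (MonoidAlgebra.single g c) • x = _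
    rw [MonoidAlgebra.mapDomainRingHom_apply, MonoidAlgebra.mapDomain_single]
  have hC : ∀ (g : Γ') (c : ℂ) (x : cokernelModule P.complex i),
      MonoidAlgebra.single g c • x = MonoidAlgebra.single (j g) c • x := by
    intro g c x
    change MonoidAlgebra.mapDomainRingHom ℂ j (MonoidAlgebra.single g c) • x = _
    rw [MonoidAlgebra.mapDomainRingHom_apply, MonoidAlgebra.mapDomain_single]
  have hX' : ∀ a ≤ n + 1, Module.Finite (MonoidAlgebra ℂ Γ') (P.complex.X a) ∧
      Module.Projective (MonoidAlgebra ℂ Γ') (P.complex.X a) := fun a ha =>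
    have := hP a ha
    have := hproj a
    finite_and_projective_of_finiteIndex j hj (hX a)
  -- a homomorphism over the larger group algebra is one over the smaller group algebra
  have restr : ∀ {M N : Type} [AddCommGroup M] [AddCommGroup N] [Module (MonoidAlgebra ℂ Γ) M]
      [Module (MonoidAlgebra ℂ Γ) N] [Module (MonoidAlgebra ℂ Γ') M] [Module (MonoidAlgebra ℂ Γ') N]
      (hM : ∀ (g : Γ') (c : ℂ) (x : M),
        MonoidAlgebra.single g c • x = MonoidAlgebra.single (j g) c • x)
      (hN : ∀ (g : Γ') (c : ℂ) (x : N),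
        MonoidAlgebra.single g c • x = MonoidAlgebra.single (j g) c • x)
      (f : M →ₗ[MonoidAlgebra ℂ Γ] N), ∃ f' : M →ₗ[MonoidAlgebra ℂ Γ'] N, ∀ x, f' x = f x :=
    fun hM hN f => ⟨linearOfEquivariant f.toAddMonoidHom fun g c x => by
      rw [hM, hN]
      exact map_smul f _ x, fun _ => rfl⟩
  have := hP i (by omega)
  have := hP (i + 1) (by omega)
  have := hP (i - 1) (by omega)
  have := hproj i
  have := hproj (i - 1)
  have := (hX' i (by omega)).1
  have := (hX' i (by omega)).2
  have := (hX' (i + 1) (by omega)).1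
  have := (hX' (i - 1) (by omega)).1
  have := (hX' (i - 1) (by omega)).2
  have : Module.FinitePresentation (MonoidAlgebra ℂ Γ) (cokernelModule P.complex i) :=
    finitePresentation_cokernelModule (P.complex.d (i + 1) i).hom (Submodule.mkQ _)
      (Submodule.mkQ_surjective _) (Submodule.ker_mkQ _).symm
  have : Module.FinitePresentation (MonoidAlgebra ℂ Γ') (cokernelModule P.complex i) := by
    obtain ⟨f, hf⟩ := restr (hX _) (hX _) (P.complex.d (i + 1) i).hom
    obtain ⟨q, hq⟩ := restr (hX _) hC
      (Submodule.mkQ (LinearMap.range (P.complex.d (i + 1) i).hom))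
    refine finitePresentation_cokernelModule f q (fun x => ?_) ?_
    · obtain ⟨y, hy⟩ := Submodule.mkQ_surjective _ x
      exact ⟨y, (hq y).trans hy⟩
    · ext x
      rw [LinearMap.mem_ker, hq, Submodule.mkQ_apply, Submodule.Quotient.mk_eq_zero]
      simp only [LinearMap.mem_range, hf]
  obtain ⟨d', hd'⟩ := restr hC (hX _) (cokernelDiff P.complex i)
  obtain ⟨D⟩ := MatrixPresentation.nonempty (cokernelDiff P.complex i)
  obtain ⟨D'⟩ := MatrixPresentation.nonempty d'
  have hharm := ker_le_closure_range (ofGroupMatrix_rel_mat D) (harmonic_eq_bot P i D hb)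
  have hharm' := ker_le_closure_range_of_finiteIndex j hj hC (hX _) hd' D D' hharm
  refine ⟨D'.k, D'.m, D'.l, D'.rel, D'.mat, fun Z χ hZ => trace_rel_add_trace_mat D' hharm' Z hZ χ,
    fun W _ _ _ ρ σ hσ => groupCohomology_bound j P i hC (hX _) d' hd' D' ρ σ hσ⟩

end

end SemisimpleGrowth

end

open SemisimpleGrowth in
theorem mainTheorem8 {N : ℕ} (G : Subgroup (GL (Fin N) ℂ)) (hG : IsSemisimpleGroup G)
    {rk : ℕ} (D : SimpleSystem G rk) (Γ : Subgroup G)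
    (htf : ∀ g : Γ, g ≠ 1 → ¬ IsOfFinOrder g) (n : ℕ) (hFP : IsTypeFP Γ (n + 1))
    (hconj : VirtuallyQuantitativeRankConjecture D Γ)
    (i : ℕ) (hi : i ≤ n) (hbetti : l2Betti Γ i = 0) :
    ∃ C : ℝ, ∀ (W : Type) [AddCommGroup W] [Module ℂ W] (ρ : Representation ℂ G W)
      (l : Fin rk → ℕ), IsIrrepOfWeight D ρ l → 0 < ⨅ j, l j →
      FiniteDimensional ℂ (groupCohomology (Rep.of (ρ.comp Γ.subtype)) i) ∧
      (Module.finrank ℂ (groupCohomology (Rep.of (ρ.comp Γ.subtype)) i) : ℝ) /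
        Module.finrank ℂ W ≤ C / ((⨅ j, l j : ℕ) : ℝ) := by
  obtain ⟨Γ', hΓ', hidx, hQ⟩ := hconj
  have hfinZ := hG.finite_center
  have : Fintype (Subgroup.center G →* ℂˣ) := Fintype.ofFinite _
  let j : Γ' →* Γ := Subgroup.inclusion hΓ'
  have hj : Function.Injective j := Subgroup.inclusion_injective hΓ'
  have hfi : j.range.FiniteIndex := ⟨by
    rw [Subgroup.inclusion_range]
    exact hidx⟩
  -- a torsion-free group meets the finite centre trivially, so that the twist by a central
  -- character disappears
  have htf' : ∀ g : Γ', g ≠ 1 → ¬ IsOfFinOrder g := fun g hg hfin =>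
    htf (j g) (fun h => hg (hj (h.trans (map_one j).symm))) (j.isOfFinOrder hfin)
  have hbot := subgroupOf_center_eq_bot Γ' htf'
  obtain ⟨k, m, s, T, A, htr, hbound⟩ := exists_matrices j hj hFP hi hbetti
  choose CT hCT using fun χ => hQ χ m k T
  choose CA hCA using fun χ => hQ χ k s A
  -- the centre has finitely many characters, and one constant serves for all of them
  refine ⟨∑ χ, (|CT χ| + |CA χ|), fun W _ _ ρ l hρ hl => ?_⟩
  have := hρ.finiteDimensional
  obtain ⟨χ, hχ⟩ := exists_hasCentralCharacter ρ hρ.irreducible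
  obtain ⟨hfd, hle⟩ := hbound W (ρ.comp Γ.subtype) (ρ.comp Γ'.subtype) fun _ => rfl
  refine ⟨hfd, ?_⟩
  have hT := (abs_le.1 (hCT χ W ρ l hρ hχ hl)).1
  have hA := (abs_le.1 (hCA χ W ρ l hρ hχ hl)).1
  have hsum := htr _ (restrictCentral Γ' χ) hbot
  have hl' : (0 : ℝ) < ((⨅ j, l j : ℕ) : ℝ) := Nat.cast_pos.2 hl
  have hC : (CT χ + CA χ) / ((⨅ j, l j : ℕ) : ℝ) ≤
      (∑ χ, (|CT χ| + |CA χ|)) / ((⨅ j, l j : ℕ) : ℝ) := by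
    refine div_le_div_of_nonneg_right ?_ hl'.le
    refine le_trans (add_le_add (le_abs_self _) (le_abs_self _)) ?_
    exact Finset.single_le_sum (f := fun χ => |CT χ| + |CA χ|) (fun χ _ => by positivity)
      (Finset.mem_univ χ)
  refine le_trans ?_ hC
  have hrn := LinearMap.finrank_range_add_finrank_ker (matrixAction (ρ.comp Γ'.subtype) T)
  -- rank–nullity on `W ^ k` turns the bound by the kernel of `T` into one by its rank
  rw [Module.finrank_pi_fintype, Finset.sum_const, Finset.card_univ, Fintype.card_fin,
    smul_eq_mul] at hrn
  have hle' : Module.finrank ℂ (groupCohomology (Rep.of (ρ.comp Γ.subtype)) i) +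
      Module.finrank ℂ (LinearMap.range (matrixAction (ρ.comp Γ'.subtype) T)) +
      Module.finrank ℂ (LinearMap.range (matrixAction (ρ.comp Γ'.subtype) A)) ≤
      k * Module.finrank ℂ W := by omega
  have hreal : (Module.finrank ℂ (groupCohomology (Rep.of (ρ.comp Γ.subtype)) i) : ℝ) /
      Module.finrank ℂ W + repRank (ρ.comp Γ'.subtype) T + repRank (ρ.comp Γ'.subtype) A ≤ k := by
    rw [repRank, repRank, ← add_div, ← add_div]
    exact div_le_of_le_mul₀ (Nat.cast_nonneg _) (Nat.cast_nonneg _) (by exact_mod_cast hle')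
  rw [add_div]
  linarith
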